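/- Let $d\ge 1$ be an integer. Functions are complex valued unless stated otherwise, and $a_-=\max\{-a,0\}$. For real-valued $V\in L^{1+d/2}(\mathbb R^d)$ let $-\Delta+V$ denote the operator in $L^2(\mathbb R^d)$ induced by the quadratic form $u\mapsto\int_{\mathbb R^d}(|\nabla u|^2+V|u|^2)\,dx$ with form domain $H^1(\mathbb R^d)$; that is, $u$ belongs to its domain and $(-\Delta+V)u=f$ if and only if $u\in H^1(\mathbb R^d)$, $f\in L^2(\mathbb R^d)$ and $\int_{\mathbb R^d}(\overline{\nabla v}\cdot\nabla u+V\,\overline v\,u)\,dx=\int_{\mathbb R^d}\overline v f\,dx$ for all $v\in H^1(\mathbb R^d)$. Let $\sum_n|E_n(-\Delta+V)|$ denote the sum of the absolute values of the negative eigenvalues of $-\Delta+V$, each repeated according to its multiplicity. Then there is a constant $L_d<\infty$ such that for every real-valued $V\in L^{1+d/2}(\mathbb R^d)$ $$\sum_n|E_n(-\Delta+V)|\le L_d\int_{\mathbb R^d}V(x)_-^{1+\frac d2}\,dx .\tag{1}$$ Moreover, (1) is equivalent to the Lieb–Thirring inequality for orthonormal functions, namely $$\sum_{n=1}^N\int_{\mathbb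 R^d}|\nabla u_n|^2\,dx\ \ge\ K_d\int_{\mathbb R^d}\Big(\sum_{n=1}^N|u_n|^2\Big)^{1+\frac2d}dx\tag{2}$$ for all $N\in\mathbb N$ and all $u_1,\dots,u_N\in H^1(\mathbb R^d)$ that are orthonormal in $L^2(\mathbb R^d)$, in the following sense: there is a smallest constant $L_d\ge0$ for which (1) holds for all such $V$, there is a largest constant $K_d\ge 0$ for which (2) holds for all such $N$ and $u_1,\dots,u_N$, and these optimal constants satisfy $$\Big(\big(1+\tfrac d2\big)L_d\Big)^{1+\frac2d}\Big(\big(1+\tfrac2d\big)K_d\Big)^{1+\frac d2}=1 .$$ In particular, both optimal constants are positive and finite. -/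

import Mathlib

open MeasureTheory
open scoped ENNReal NNReal SchwartzMap LineDeriv ComplexConjugate

noncomputable section

namespace LiebThirring

/-- The Euclidean space `ℝ^d`. -/
abbrev Space (d : ℕ) : Type := EuclideanSpace ℝ (Fin d)

/-- The complex Hilbert space `L²(ℝ^d)`. -/
abbrev L2 (d : ℕ) : Type := Lp ℂ 2 (volume : Measure (Space d))

/-- The tempered distribution defined by an `L²` function (as a linear map). -/
abbrev toDistr (d : ℕ) : L2 d →L[ℂ] 𝓢'(Space d, ℂ) :=
  Lp.toTemperedDistributionCLM ℂ (volume : Measure (Space d)) 2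

theorem toDistr_injective (d : ℕ) : Function.Injective (toDistr d) :=
  LinearMap.ker_eq_bot.mp Lp.ker_toTemperedDistributionCLM_eq_bot

/-- The Sobolev space `H¹(ℝ^d)`, as a subspace of `L²(ℝ^d)`. -/
def H1 (d : ℕ) : Submodule ℂ (L2 d) where
  carrier := {u | TemperedDistribution.MemSobolev 1 2 (toDistr d u)}
  add_mem' {u v} hu hv := by
    simp only [Set.mem_ofPred_eq, map_add] at *
    exact hu.add hv
  zero_mem' := by
    change TemperedDistribution.MemSobolev 1 2 (toDistr d 0)
    rw [map_zero]
    exact TemperedDistribution.memSobolev_fun_zero _ _ 1 2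
  smul_mem' c u hu := by
    simp only [Set.mem_ofPred_eq, map_smul] at *
    exact hu.smul c

theorem exists_weakPartial {d : ℕ} (i : Fin d) (u : H1 d) :
    ∃ g : L2 d, toDistr d g = ∂_{EuclideanSpace.single i (1 : ℝ)} (toDistr d u) := by
  have h := TemperedDistribution.MemSobolev.lineDerivOp
    (show TemperedDistribution.MemSobolev 1 2 (toDistr d u) from u.2)
    (m := EuclideanSpace.single i (1 : ℝ))
  rw [sub_self, TemperedDistribution.memSobolev_zero_iff] at h
  obtain ⟨g, hg⟩ := h
  exact ⟨g, hg.symm⟩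

/-- The weak partial derivative `∂ᵢ : H¹(ℝ^d) → L²(ℝ^d)`: the `L²` function representing the
`i`-th distributional derivative. -/
def weakPartial {d : ℕ} (i : Fin d) : H1 d →ₗ[ℂ] L2 d where
  toFun u := (exists_weakPartial i u).choose
  map_add' u v := by
    apply toDistr_injective d
    rw [map_add, (exists_weakPartial i u).choose_spec, (exists_weakPartial i v).choose_spec,
      (exists_weakPartial i (u + v)).choose_spec, Submodule.coe_add, map_add,
      LineDeriv.lineDerivOp_add]
  map_smul' c u := by
    apply toDistr_injective d
    rw [RingHom.id_apply, map_smul, (exists_weakPartial i u).choose_spec,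
      (exists_weakPartial i (c • u)).choose_spec, Submodule.coe_smul, map_smul,
      LineDeriv.lineDerivOp_smul]

/-- The defining property of the weak derivative. -/
theorem toDistr_weakPartial {d : ℕ} (i : Fin d) (u : H1 d) :
    toDistr d (weakPartial i u) = ∂_{EuclideanSpace.single i (1 : ℝ)} (toDistr d u) :=
  (exists_weakPartial i u).choose_spec

theorem dense_H1 (d : ℕ) : Dense (H1 d : Set (L2 d)) := by
  have h : DenseRange (SchwartzMap.toLpCLM ℝ ℂ 2 (volume : Measure (Space d))) :=
    SchwartzMap.denseRange_toLpCLM ENNReal.ofNat_ne_top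
  refine Dense.mono ?_ h
  rintro _ ⟨f, rfl⟩
  change TemperedDistribution.MemSobolev 1 2 _
  have h2 : toDistr d (SchwartzMap.toLpCLM ℝ ℂ 2 (volume : Measure (Space d)) f)
      = (f : 𝓢'(Space d, ℂ)) := Lp.toTemperedDistribution_toLp_eq f
  rw [h2]
  exact f.memSobolev

/-- The integrand `V(x) * conj (v x) * u x` of the potential part of the form. -/
def potentialIntegrand {d : ℕ} (V : Space d → ℝ) (v u : H1 d) (x : Space d) : ℂ :=
  (V x : ℂ) * (conj ((v : L2 d) x) * (u : L2 d) x)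

/-- The sesquilinear form `∫ (conj (∇v) · ∇u + V conj(v) u) dx` on `H¹(ℝ^d)`; its diagonal is the
quadratic form `∫ (|∇u|² + V |u|²) dx`. -/
def schrodingerForm {d : ℕ} (V : Space d → ℝ) (v u : H1 d) : ℂ :=
  (∑ i : Fin d, inner ℂ (weakPartial i v) (weakPartial i u))
    + ∫ x, potentialIntegrand V v u x

theorem potentialIntegrand_add {d : ℕ} (V : Space d → ℝ) (v u u' : H1 d) :
    potentialIntegrand V v (u + u') =ᵐ[volume]
      potentialIntegrand V v u + potentialIntegrand V v u' := by
  filter_upwards [Lp.coeFn_add (u : L2 d) (u' : L2 d)] with x hx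
  simp only [potentialIntegrand, Submodule.coe_add, Pi.add_apply, hx]
  ring

theorem potentialIntegrand_smul {d : ℕ} (V : Space d → ℝ) (v u : H1 d) (c : ℂ) :
    potentialIntegrand V v (c • u) =ᵐ[volume] c • potentialIntegrand V v u := by
  filter_upwards [Lp.coeFn_smul c (u : L2 d)] with x hx
  simp only [potentialIntegrand, Submodule.coe_smul, Pi.smul_apply, hx, smul_eq_mul]
  ring

/-- The graph of the operator induced by the form: all `(u, f)` with `u ∈ H¹`, `f ∈ L²` and
`a_V(v, u) = ⟨v, f⟩` for every `v ∈ H¹`. (The integrability of the potential term is part of the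
requirement; it is automatic for `V ∈ L^{1+d/2}`.) -/
def schrodingerGraph {d : ℕ} (V : Space d → ℝ) : Submodule ℂ (L2 d × L2 d) where
  carrier := {p | ∃ u : H1 d, (u : L2 d) = p.1 ∧
    ∀ v : H1 d, Integrable (potentialIntegrand V v u) ∧
      schrodingerForm V v u = inner ℂ (v : L2 d) p.2}
  add_mem' := by
    rintro p q ⟨u, hu, h⟩ ⟨u', hu', h'⟩
    refine ⟨u + u', by simp [hu, hu'], fun v => ⟨?_, ?_⟩⟩
    · exact ((h v).1.add (h' v).1).congr (potentialIntegrand_add V v u u').symm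
    · rw [Prod.snd_add, inner_add_right, ← (h v).2, ← (h' v).2, schrodingerForm,
        integral_congr_ae (potentialIntegrand_add V v u u'), integral_add' (h v).1 (h' v).1]
      simp only [schrodingerForm, map_add, inner_add_right, Finset.sum_add_distrib]
      ring
  zero_mem' := by
    refine ⟨0, rfl, fun v => ?_⟩
    have h0 : potentialIntegrand V v 0 =ᵐ[volume] 0 := by
      have := potentialIntegrand_smul V v 0 0
      simpa using this
    refine ⟨(integrable_zero _ _ _).congr h0.symm, ?_⟩
    rw [schrodingerForm, integral_congr_ae h0]
    simp
  smul_mem' := by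
    rintro c p ⟨u, hu, h⟩
    refine ⟨c • u, by simp [hu], fun v => ⟨?_, ?_⟩⟩
    · exact ((h v).1.smul c).congr (potentialIntegrand_smul V v u c).symm
    · rw [Prod.smul_snd, inner_smul_right, ← (h v).2, schrodingerForm,
        integral_congr_ae (potentialIntegrand_smul V v u c)]
      simp only [schrodingerForm, map_smul, inner_smul_right, Pi.smul_apply, smul_eq_mul,
        ← Finset.mul_sum, integral_const_mul, mul_add]

/-- `schrodingerGraph V` is single-valued, so it is the graph of an operator. -/
theorem schrodingerGraph_singleValued {d : ℕ} (V : Space d → ℝ) (p : L2 d × L2 d)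
    (hp : p ∈ schrodingerGraph V) (h0 : p.1 = 0) : p.2 = 0 := by
  obtain ⟨u, hu, h⟩ := hp
  have hu0 : u = 0 := Subtype.ext (hu.trans h0)
  subst hu0
  obtain ⟨u', hu', h'⟩ := (schrodingerGraph V).zero_mem
  have hu0' : u' = 0 := Subtype.ext hu'
  subst hu0'
  refine (dense_H1 d).eq_zero_of_inner_right ℂ fun v hv => ?_
  have h1 := (h ⟨v, hv⟩).2
  have h2 := (h' ⟨v, hv⟩).2
  rw [h2] at h1
  simpa using h1.symm

/-- The Schrödinger operator `-Δ + V` in `L²(ℝ^d)`: the operator induced by the quadratic form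
`∫ (|∇u|² + V |u|²) dx` with form domain `H¹(ℝ^d)`. -/
def schrodingerOperator {d : ℕ} (V : Space d → ℝ) : L2 d →ₗ.[ℂ] L2 d :=
  (schrodingerGraph V).toLinearPMap

theorem graph_schrodingerOperator {d : ℕ} (V : Space d → ℝ) :
    (schrodingerOperator V).graph = schrodingerGraph V :=
  Submodule.toLinearPMap_graph_eq _ (schrodingerGraph_singleValued V)

/-- The multiplicity of `E` as an eigenvalue of `A`, i.e. the dimension of `ker (A - E)`
(`0` if `E` is not an eigenvalue, `⊤` if the eigenspace is infinite-dimensional). -/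
def eigenMultiplicity {d : ℕ} (A : L2 d →ₗ.[ℂ] L2 d) (E : ℝ) : ℕ∞ :=
  Cardinal.toENat (Module.rank ℂ (LinearMap.ker (A.toFun - (E : ℂ) • A.domain.subtype)))

/-- `∑ₙ |Eₙ(A)|`: the sum of the absolute values of all negative eigenvalues of `A`, each repeated
according to its multiplicity (a number in `[0, ∞]`). -/
def sumAbsNegEigenvalues {d : ℕ} (A : L2 d →ₗ.[ℂ] L2 d) : ℝ≥0∞ :=
  ∑' E : Set.Iio (0 : ℝ), (eigenMultiplicity A E : ℝ≥0∞) * ENNReal.ofReal |(E : ℝ)|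

/-- The constant `L` is admissible in the Lieb–Thirring inequality for Schrödinger operators:
`∑ₙ |Eₙ(-Δ + V)| ≤ L ∫ V_-^{1+d/2} dx` for all real `V ∈ L^{1+d/2}(ℝ^d)`. -/
def SchrodingerLT (d : ℕ) (L : ℝ≥0) : Prop :=
  ∀ V : Space d → ℝ, MemLp V (ENNReal.ofReal (1 + d / 2)) volume →
    sumAbsNegEigenvalues (schrodingerOperator V)
      ≤ L * ∫⁻ x, ENNReal.ofReal (max (-V x) 0 ^ (1 + d / 2 : ℝ))

/-- The constant `K` is admissible in the Lieb–Thirring inequality for orthonormal functions: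
`∑ₙ ∫ |∇uₙ|² dx ≥ K ∫ (∑ₙ |uₙ|²)^{1+2/d} dx` for all `N` and all `u₁, …, u_N ∈ H¹(ℝ^d)` that are
orthonormal in `L²(ℝ^d)`. -/
def OrthonormalLT (d : ℕ) (K : ℝ≥0) : Prop :=
  ∀ (N : ℕ) (u : Fin N → H1 d), Orthonormal ℂ (fun n => (u n : L2 d)) →
    K * ∫⁻ x, ENNReal.ofReal ((∑ n, ‖(u n : L2 d) x‖ ^ 2) ^ (1 + 2 / d : ℝ))
      ≤ ∑ n, ∫⁻ x, ENNReal.ofReal (∑ i, ‖weakPartial i (u n) x‖ ^ 2)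

end LiebThirring

end

noncomputable section

namespace LiebThirring

open FourierTransform Filter Topology

variable {d : ℕ}

/-! Put p = 1 + d/2, q = 1 + 2/d (conjugate exponents) and ρ = ∑ |uₙ|². The functions L vᵖ and K t^q
are Legendre dual exactly when pL(qK)^(d/2) = 1, the relation `DualConstants`. Each inequality holds
with its constant if and only if the other holds with the dual one, so it suffices to prove one of
them with some positive constant.

The orthonormal inequality is proved by Rumin's method (`exists_orthonormalLT`). Cut every uₙ at
frequency √t. By Bessel the low-frequency density is at most the volume of the ball of radius √t, so
where ρ is at least four times that volume it is controlled by the high-frequency density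
(`setLIntegral_density_le`). Integrating over t, the high-frequency masses add up to the kinetic
energy and the left side becomes a multiple of ∫ ρ^q.

From orthonormal functions to operators, sum the energies of orthonormal eigenfunctions and apply
Young's inequality to ∫ V₋ρ (`SchrodingerLT.of_orthonormalLT`). Conversely, insert truncations of
the optimal potential -qKρ^(2/d) into the variational principle for the eigenvalue sum
(`OrthonormalLT.of_schrodingerLT`). That principle concerns eigenvalues only, so eigenfunctions have
to be produced: for bounded potentials of bounded support they are obtained by minimizing the energy
on the orthogonal complement of those already found, with compactness supplied by
`IsCutoffWeight.exists_finset_integral_le`.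

Duality reverses the order of constants and so exchanges the least L and the greatest K; one nonzero
function bounds K from above, which forces L > 0. -/

/-! ### L² norms, the Fourier transform and H¹ -/

theorem ofReal_norm_sq_eq_lintegral (f : L2 d) :
    ENNReal.ofReal (‖f‖ ^ 2) = ∫⁻ x, ENNReal.ofReal (‖f x‖ ^ 2) := by
  have h : ENNReal.ofReal (‖f‖ ^ 2) = (eLpNorm f 2 volume) ^ 2 := by
    rw [Lp.norm_def, ← ENNReal.toReal_pow, ENNReal.ofReal_toReal]
    exact ENNReal.pow_ne_top (Lp.memLp f).eLpNorm_ne_top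
  rw [h, eLpNorm_eq_lintegral_rpow_enorm_toReal two_ne_zero ENNReal.ofNat_ne_top,
    ← ENNReal.rpow_natCast, ← ENNReal.rpow_mul]
  norm_num

theorem norm_sq_eq_integral (f : L2 d) : ‖f‖ ^ 2 = ∫ x, ‖f x‖ ^ 2 := by
  have hm : AEStronglyMeasurable (fun x => ‖f x‖ ^ 2) volume :=
    (Lp.aestronglyMeasurable f).norm.pow 2
  rw [integral_eq_lintegral_of_nonneg_ae (ae_of_all _ fun x => by positivity) hm,
    ← ofReal_norm_sq_eq_lintegral,
    ENNReal.toReal_ofReal (by positivity)]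

theorem integrable_norm_sq (f : L2 d) : Integrable (fun x => ‖f x‖ ^ 2) :=
  (Lp.memLp f).integrable_norm_pow two_ne_zero

theorem inner_eq_integral (f g : L2 d) : inner ℂ f g = ∫ x, conj (f x) * g x := by
  rw [L2.inner_def]
  refine integral_congr_ae (ae_of_all _ fun x => ?_)
  simp [mul_comm]

/-- Compactly supported smooth functions are Schwartz, so the du Bois-Reymond lemma applies. This
turns identities of tempered distributions into almost-everywhere identities. -/
theorem ae_eq_of_integral_schwartz_mul_eq {f g : Space d → ℂ} (hf : LocallyIntegrable f)
    (hg : LocallyIntegrable g)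
    (h : ∀ φ : 𝓢(Space d, ℂ), ∫ x, φ x * f x = ∫ x, φ x * g x) : f =ᵐ[volume] g := by
  refine ae_eq_of_integral_contDiff_smul_eq hf hg fun φ φ_smooth φ_cpt => ?_
  have h₁ : HasCompactSupport (Complex.ofRealCLM ∘ φ) := φ_cpt.comp_left rfl
  have h₂ : ContDiff ℝ ((⊤ : ℕ∞) : WithTop ℕ∞) (Complex.ofRealCLM ∘ φ) := by fun_prop
  simpa using! h (h₁.toSchwartzMap h₂)

theorem toDistr_apply (f : L2 d) (φ : 𝓢(Space d, ℂ)) : toDistr d f φ = ∫ x, φ x * f x := by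
  change (f : 𝓢'(Space d, ℂ)) φ = _
  rw [Lp.toTemperedDistribution_apply]
  rfl

/-- The L² inverse transform is defined abstractly; this makes it an explicit integral, which is
needed for band-limited functions. -/
theorem fourierInv_coe_ae (f : L2 d) (hf : Integrable f) :
    (𝓕⁻ f : L2 d) =ᵐ[volume] 𝓕⁻ (f : Space d → ℂ) := by
  have hcont : Continuous (𝓕⁻ (f : Space d → ℂ)) := by
    rw [Real.fourierInv_eq_fourier_comp_neg]
    exact VectorFourier.fourierIntegral_continuous Real.continuous_fourierChar
      (by exact continuous_inner) hf.comp_neg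
  refine ae_eq_of_integral_schwartz_mul_eq
    ((Lp.memLp _).locallyIntegrable (by norm_num)) hcont.locallyIntegrable fun φ => ?_
  have h1 := congrArg (fun T : 𝓢'(Space d, ℂ) => T φ) (Lp.fourierInv_toTemperedDistribution_eq f)
  simp only [TemperedDistribution.fourierInv_apply] at h1
  have h2 := toDistr_apply (𝓕⁻ f) φ
  have h3 := toDistr_apply f (𝓕⁻ φ)
  rw [← h2]
  refine h1.symm.trans (h3.trans ?_)
  -- Multiplication formula: the inverse transform is the Fourier integral for the pairing -⟨·,·⟩,
  -- and since this pairing is symmetric the transform moves unchanged from one factor to the other.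
  have h4 := VectorFourier.integral_fourierIntegral_smul_eq_flip (L := - innerₗ (Space d))
    (μ := volume) (ν := volume) Real.continuous_fourierChar
    (by exact continuous_inner.neg) φ.integrable hf
  have hflip : (-innerₗ (Space d)).flip = - innerₗ (Space d) := by
    ext x y; simp [real_inner_comm]
  rw [hflip] at h4
  simp only [SchwartzMap.fourierInv_coe]
  exact h4

/-- Two `L²` functions related by multiplication as distributions are related pointwise. -/
theorem ae_eq_mul_of_smulLeftCLM_eq {g : Space d → ℂ} (hg : g.HasTemperateGrowth) (f f' : L2 d) :
    TemperedDistribution.smulLeftCLM ℂ g (toDistr d f) = toDistr d f' ↔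
      f' =ᵐ[volume] fun x => g x * f x := by
  have key : ∀ φ : 𝓢(Space d, ℂ), TemperedDistribution.smulLeftCLM ℂ g (toDistr d f) φ
      = ∫ x, φ x * (g x * f x) := fun φ => by
    rw [TemperedDistribution.smulLeftCLM_apply_apply, toDistr_apply]
    refine integral_congr_ae (ae_of_all _ fun x => ?_)
    simp only [SchwartzMap.smulLeftCLM_apply_apply hg, smul_eq_mul]
    ring
  constructor
  · intro h
    refine ae_eq_of_integral_schwartz_mul_eq
      ((Lp.memLp _).locallyIntegrable (by norm_num)) ?_ fun φ => ?_
    · exact ((Lp.memLp f).locallyIntegrable (by norm_num)).continuous_smul hg.1.continuous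
    · rw [← toDistr_apply, ← h, key]
  · intro h
    ext φ
    rw [key, toDistr_apply]
    refine integral_congr_ae ?_
    filter_upwards [h] with x hx
    rw [hx]

theorem fourier_toDistr (f : L2 d) : 𝓕 (toDistr d f) = toDistr d (𝓕 f) :=
  Lp.fourier_toTemperedDistribution_eq f

/-- The Fourier transform is injective on tempered distributions and turns ∂ᵢ into multiplication by
2πiξᵢ. -/
theorem toDistr_eq_lineDeriv_iff (i : Fin d) (f g : L2 d) :
    toDistr d g = ∂_{EuclideanSpace.single i (1 : ℝ)} (toDistr d f) ↔
      (𝓕 g : L2 d) =ᵐ[volume] fun ξ => (2 * Real.pi * Complex.I * (ξ i : ℂ)) * (𝓕 f : L2 d) ξ := by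
  have htg : Function.HasTemperateGrowth
      (fun ξ : Space d => ((inner ℝ ξ (EuclideanSpace.single i (1 : ℝ)) : ℝ) : ℂ)) := by fun_prop
  have e1 : (fun ξ : Space d => 2 * Real.pi * Complex.I * (ξ i : ℂ)) =
      (2 * Real.pi * Complex.I : ℂ) • fun ξ : Space d =>
        ((inner ℝ ξ (EuclideanSpace.single i (1 : ℝ)) : ℝ) : ℂ) := by
    ext ξ
    simp [EuclideanSpace.inner_single_right]
  have htg' : Function.HasTemperateGrowth
      (fun ξ : Space d => 2 * Real.pi * Complex.I * (ξ i : ℂ)) := by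
    rw [e1]
    exact (Function.HasTemperateGrowth.const _).mul htg
  rw [← ae_eq_mul_of_smulLeftCLM_eq htg', e1, TemperedDistribution.smulLeftCLM_smul htg,
    ← fourier_toDistr, ← fourier_toDistr, smul_apply,
    ← TemperedDistribution.fourier_lineDerivOp_eq, eq_comm]
  exact ⟨fun h => by rw [h], fun h => by
    have := congrArg (fun T : 𝓢'(Space d, ℂ) => 𝓕⁻ T) h
    simpa using this⟩

theorem fourier_weakPartial (i : Fin d) (u : H1 d) :
    (𝓕 (weakPartial i u) : L2 d) =ᵐ[volume]
      fun ξ => (2 * Real.pi * Complex.I * (ξ i : ℂ)) * (𝓕 (u : L2 d) : L2 d) ξ :=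
  (toDistr_eq_lineDeriv_iff i _ _).1 (toDistr_weakPartial i u)

/-- The squared `L²` norm of the weak gradient. -/
def gradSq (u : H1 d) : ℝ := ∑ i, ‖weakPartial i u‖ ^ 2

theorem gradSq_nonneg (u : H1 d) : 0 ≤ gradSq u := Finset.sum_nonneg fun _ _ => by positivity

theorem lintegral_weakPartial_sq (u : H1 d) :
    ∫⁻ x, ENNReal.ofReal (∑ i, ‖weakPartial i u x‖ ^ 2) = ENNReal.ofReal (gradSq u) := by
  rw [gradSq, ENNReal.ofReal_sum_of_nonneg fun _ _ => by positivity]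
  simp_rw [ofReal_norm_sq_eq_lintegral]
  rw [← lintegral_finsetSum']
  · refine lintegral_congr fun x => ?_
    rw [ENNReal.ofReal_sum_of_nonneg fun _ _ => by positivity]
  · intro i _
    exact ((Lp.aestronglyMeasurable _).norm.pow 2).aemeasurable.ennreal_ofReal

theorem gradSq_eq_lintegral (u : H1 d) :
    ENNReal.ofReal (gradSq u) =
      ∫⁻ ξ, ENNReal.ofReal (4 * Real.pi ^ 2 * ‖ξ‖ ^ 2 * ‖(𝓕 (u : L2 d) : L2 d) ξ‖ ^ 2) := by
  have h : gradSq u = ∑ i, ‖(𝓕 (weakPartial i u) : L2 d)‖ ^ 2 := by simp [gradSq]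
  rw [h, ENNReal.ofReal_sum_of_nonneg fun _ _ => by positivity]
  simp_rw [ofReal_norm_sq_eq_lintegral]
  rw [← lintegral_finsetSum']
  · refine lintegral_congr_ae ?_
    have := ae_all_iff.2 fun i => fourier_weakPartial i u
    filter_upwards [this] with ξ hξ
    rw [← ENNReal.ofReal_sum_of_nonneg fun _ _ => by positivity, EuclideanSpace.norm_sq_eq]
    congr 1
    rw [Finset.mul_sum, Finset.sum_mul]
    refine Finset.sum_congr rfl fun i _ => ?_
    rw [hξ i]
    simp only [norm_mul, Complex.norm_ofNat, Complex.norm_real, Complex.norm_I, mul_one,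
      Real.norm_eq_abs, abs_of_pos Real.pi_pos]
    ring
  · intro i _
    exact ((Lp.aestronglyMeasurable _).norm.pow 2).aemeasurable.ennreal_ofReal

/-- `H¹` is closed: weak derivatives pass to `L²` limits. -/
theorem exists_H1_of_tendsto (u : ℕ → H1 d) (f : L2 d) (g : Fin d → L2 d)
    (hu : Tendsto (fun k => (u k : L2 d)) atTop (𝓝 f))
    (hg : ∀ i, Tendsto (fun k => weakPartial i (u k)) atTop (𝓝 (g i))) :
    ∃ w : H1 d, (w : L2 d) = f ∧ ∀ i, weakPartial i w = g i := by
  -- Differentiation is continuous on distributions, so it commutes with the L² limits.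
  have hderiv : ∀ i, toDistr d (g i) = ∂_{EuclideanSpace.single i (1 : ℝ)} (toDistr d f) := by
    intro i
    have h1 := ((toDistr d).continuous.tendsto _).comp (hg i)
    have h2 := (((LineDeriv.lineDerivOpCLM ℂ 𝓢'(Space d, ℂ) (EuclideanSpace.single i (1 : ℝ))).comp
      (toDistr d)).continuous.tendsto f).comp hu
    refine tendsto_nhds_unique h1 (h2.congr fun k => ?_)
    exact (toDistr_weakPartial i (u k)).symm
  have hF := ae_all_iff.2 fun i => (toDistr_eq_lineDeriv_iff i _ _).1 (hderiv i)
  have hmem : f ∈ H1 d := by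
    change TemperedDistribution.MemSobolev 1 2 (toDistr d f)
    rw [TemperedDistribution.memSobolev_iff_exists_smulLeftCLM_fourier, fourier_toDistr]
    have hM : MemLp (fun ξ : Space d =>
        (((1 + ‖ξ‖ ^ 2) ^ ((1 : ℝ) / 2) : ℝ) : ℂ) * (𝓕 f : L2 d) ξ) 2 := by
      have hs : MemLp (fun ξ : Space d => ‖(𝓕 f : L2 d) ξ‖ +
          ∑ i, ‖(𝓕 (g i) : L2 d) ξ‖) 2 :=
        (Lp.memLp _).norm.add (memLp_finsetSum _ fun i _ => (Lp.memLp _).norm)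
      refine hs.mono ?_ ?_
      · refine AEStronglyMeasurable.mul (Continuous.aestronglyMeasurable ?_)
          (Lp.aestronglyMeasurable _)
        refine Complex.continuous_ofReal.comp (Continuous.rpow_const (by fun_prop) fun x => ?_)
        exact Or.inr (by norm_num)
      · filter_upwards [hF] with ξ hξ
        have hpi : (1 : ℝ) ≤ 2 * Real.pi := by linarith [Real.pi_gt_three]
        -- The Sobolev weight is dominated by 1 + ∑ |ξᵢ|, and |ξᵢ| times the transform of f is
        -- dominated by the transform of g i, because 2π ≥ 1.
        have e1 : ‖(((1 + ‖ξ‖ ^ 2) ^ ((1 : ℝ) / 2) : ℝ) : ℂ)‖ ≤ 1 + ∑ i, |ξ i| := by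
          rw [← Real.sqrt_eq_rpow, Complex.norm_real, Real.norm_of_nonneg (Real.sqrt_nonneg _)]
          refine Real.sqrt_le_iff.2 ⟨by positivity, ?_⟩
          rw [EuclideanSpace.norm_sq_eq]
          have : ∑ i, ‖ξ i‖ ^ 2 ≤ (∑ i, |ξ i|) ^ 2 :=
            Finset.sum_sq_le_sq_sum_of_nonneg fun i _ => abs_nonneg _
          have h0 : 0 ≤ ∑ i, |ξ i| := Finset.sum_nonneg fun _ _ => abs_nonneg _
          nlinarith
        rw [norm_mul, Real.norm_of_nonneg (by positivity)]
        refine (mul_le_mul_of_nonneg_right e1 (norm_nonneg _)).trans ?_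
        rw [add_mul, one_mul, Finset.sum_mul]
        gcongr with i
        rw [hξ i]
        simp only [norm_mul, Complex.norm_ofNat, Complex.norm_real, Complex.norm_I, mul_one,
          Real.norm_eq_abs, abs_of_pos Real.pi_pos]
        gcongr
        nlinarith [abs_nonneg (ξ i)]
    refine ⟨hM.toLp _, ?_⟩
    refine (ae_eq_mul_of_smulLeftCLM_eq (by fun_prop) _ _).2 ?_
    exact hM.coeFn_toLp
  refine ⟨⟨f, hmem⟩, rfl, fun i => ?_⟩
  apply toDistr_injective d
  rw [toDistr_weakPartial, hderiv]

/-! ### Truncated plane waves and frequency cutoffs -/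

theorem memLp_planeWave (R : ℝ) (x : Space d) :
    MemLp ((Metric.ball (0 : Space d) R).indicator
      fun ξ => Complex.exp (((-(2 * Real.pi * inner ℝ ξ x) : ℝ) : ℂ) * Complex.I)) 2 volume := by
  rw [memLp_indicator_iff_restrict measurableSet_ball]
  have : IsFiniteMeasure (volume.restrict (Metric.ball (0 : Space d) R)) :=
    ⟨by simpa using measure_ball_lt_top⟩
  refine MemLp.of_bound (Continuous.aestronglyMeasurable (by fun_prop)) 1 ?_
  exact ae_of_all _ fun ξ => (Complex.norm_exp_ofReal_mul_I _).le

/-- The plane wave `ξ ↦ exp(-2πi ξ·x)`, cut off to the ball of radius `R`. -/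
def planeWave (R : ℝ) (x : Space d) : L2 d := (memLp_planeWave R x).toLp _

theorem coeFn_planeWave (R : ℝ) (x : Space d) :
    planeWave R x =ᵐ[volume] (Metric.ball (0 : Space d) R).indicator
      fun ξ => Complex.exp (((-(2 * Real.pi * inner ℝ ξ x) : ℝ) : ℂ) * Complex.I) :=
  MemLp.coeFn_toLp _

theorem norm_planeWave_sq (R : ℝ) (x : Space d) :
    ‖planeWave R x‖ ^ 2 = volume.real (Metric.ball (0 : Space d) R) := by
  rw [norm_sq_eq_integral, ← integral_indicator_one measurableSet_ball]
  refine integral_congr_ae ?_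
  filter_upwards [coeFn_planeWave R x] with ξ hξ
  rw [hξ]
  by_cases h : ξ ∈ Metric.ball (0 : Space d) R
  · simp only [Set.indicator_of_mem h, Complex.norm_exp_ofReal_mul_I, Pi.one_apply, one_pow]
  · simp [Set.indicator_of_notMem h]

theorem norm_exp_mul_I_sub_le (a b : ℝ) :
    ‖Complex.exp ((a : ℂ) * Complex.I) - Complex.exp ((b : ℂ) * Complex.I)‖ ≤ |a - b| := by
  have h : Complex.exp ((a : ℂ) * Complex.I) - Complex.exp ((b : ℂ) * Complex.I) =
      Complex.exp ((b : ℂ) * Complex.I) * (Complex.exp (Complex.I * ((a - b : ℝ) : ℂ)) - 1) := by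
    rw [mul_sub, mul_one, ← Complex.exp_add]
    congr 2
    push_cast; ring
  rw [h, norm_mul, Complex.norm_exp_ofReal_mul_I, one_mul]
  exact Real.norm_exp_I_mul_ofReal_sub_one_le

theorem norm_planeWave_sub_sq_le (R : ℝ) (x y : Space d) :
    ‖planeWave R x - planeWave R y‖ ^ 2 ≤
      volume.real (Metric.ball (0 : Space d) R) * (2 * Real.pi * R * ‖x - y‖) ^ 2 := by
  have hint : Integrable ((Metric.ball (0 : Space d) R).indicator
      fun _ => (2 * Real.pi * R * ‖x - y‖) ^ 2) :=
    (integrable_indicator_iff measurableSet_ball).2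
      (integrableOn_const (measure_ball_lt_top.ne))
  rw [norm_sq_eq_integral]
  refine (integral_mono_ae (integrable_norm_sq _) hint ?_).trans ?_
  · filter_upwards [coeFn_planeWave R x, coeFn_planeWave R y,
      Lp.coeFn_sub (planeWave R x) (planeWave R y)] with ξ h1 h2 h3
    rw [h3, Pi.sub_apply, h1, h2]
    by_cases h : ξ ∈ Metric.ball (0 : Space d) R
    · simp only [Set.indicator_of_mem h]
      gcongr
      refine (norm_exp_mul_I_sub_le _ _).trans ?_
      have h4 : -(2 * Real.pi * inner ℝ ξ x) - -(2 * Real.pi * inner ℝ ξ y) =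
          -(2 * Real.pi * inner ℝ ξ (x - y)) := by rw [inner_sub_right]; ring
      rw [h4, abs_neg, abs_mul, abs_of_pos (by positivity), mul_assoc (2 * Real.pi)]
      gcongr
      refine (abs_real_inner_le_norm _ _).trans ?_
      gcongr
      exact (mem_ball_zero_iff.1 h).le
    · simp [Set.indicator_of_notMem h]
  · rw [integral_indicator measurableSet_ball, setIntegral_const, smul_eq_mul]

/-- On bounded frequencies the phases are uniformly Lipschitz in x. Hence the plane waves with x in
a compact set form a compact subset of L², the source of compactness later on. -/
theorem continuous_planeWave (R : ℝ) : Continuous (planeWave (d := d) R) := by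
  rw [continuous_iff_continuousAt]
  intro x
  rw [ContinuousAt, tendsto_iff_norm_sub_tendsto_zero]
  have h : Tendsto (fun y => Real.sqrt (volume.real (Metric.ball (0 : Space d) R) *
      (2 * Real.pi * R * ‖y - x‖) ^ 2)) (𝓝 x) (𝓝 0) := by
    have : Continuous fun y => Real.sqrt (volume.real (Metric.ball (0 : Space d) R) *
      (2 * Real.pi * R * ‖y - x‖) ^ 2) := by fun_prop
    simpa using this.tendsto x
  refine squeeze_zero (fun _ => norm_nonneg _) (fun y => ?_) h
  exact Real.le_sqrt_of_sq_le (norm_planeWave_sub_sq_le R y x)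

/-- Restriction of an `L²` function to the ball of radius `R`. -/
def lowPart (R : ℝ) (f : L2 d) : L2 d :=
  ((Lp.memLp f).indicator (measurableSet_ball (x := (0 : Space d)) (ε := R))).toLp _

/-- Restriction of an `L²` function to the complement of the ball of radius `R`. -/
def highPart (R : ℝ) (f : L2 d) : L2 d :=
  ((Lp.memLp f).indicator (measurableSet_ball (x := (0 : Space d)) (ε := R)).compl).toLp _

theorem coeFn_lowPart (R : ℝ) (f : L2 d) :
    lowPart R f =ᵐ[volume] (Metric.ball (0 : Space d) R).indicator f := MemLp.coeFn_toLp _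

theorem coeFn_highPart (R : ℝ) (f : L2 d) :
    highPart R f =ᵐ[volume] (Metric.ball (0 : Space d) R)ᶜ.indicator f := MemLp.coeFn_toLp _

theorem lowPart_add_highPart (R : ℝ) (f : L2 d) : lowPart R f + highPart R f = f := by
  apply Lp.ext
  filter_upwards [coeFn_lowPart R f, coeFn_highPart R f, Lp.coeFn_add (lowPart R f) (highPart R f)]
    with x h1 h2 h3
  rw [h3, Pi.add_apply, h1, h2, ← Pi.add_apply, Set.indicator_self_add_compl]

theorem norm_highPart_sq (R : ℝ) (f : L2 d) :
    ENNReal.ofReal (‖highPart R f‖ ^ 2) =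
      ∫⁻ ξ in (Metric.ball (0 : Space d) R)ᶜ, ENNReal.ofReal (‖f ξ‖ ^ 2) := by
  rw [ofReal_norm_sq_eq_lintegral, ← lintegral_indicator measurableSet_ball.compl]
  refine lintegral_congr_ae ?_
  filter_upwards [coeFn_highPart R f] with ξ hξ
  rw [hξ]
  by_cases h : ξ ∈ (Metric.ball (0 : Space d) R)ᶜ
  · simp only [Set.indicator_of_mem h]
  · simp [Set.indicator_of_notMem h]

/-- Evaluation of a band-limited function at a point is an inner product with a fixed L² vector;
this is what allows Bessel's inequality to be used pointwise. -/
theorem fourierInv_lowPart (R : ℝ) (f : L2 d) :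
    (𝓕⁻ (lowPart R f) : L2 d) =ᵐ[volume] fun x => inner ℂ (planeWave R x) f := by
  have hint : Integrable (lowPart R f) := by
    refine Integrable.congr ?_ (coeFn_lowPart R f).symm
    rw [integrable_indicator_iff measurableSet_ball]
    have : IsFiniteMeasure (volume.restrict (Metric.ball (0 : Space d) R)) :=
      ⟨by simpa using measure_ball_lt_top⟩
    exact ((Lp.memLp f).restrict _).integrable (by norm_num)
  filter_upwards [fourierInv_coe_ae _ hint] with x hx
  rw [hx, Real.fourierInv_eq', inner_eq_integral]
  refine integral_congr_ae ?_
  filter_upwards [coeFn_lowPart R f, coeFn_planeWave R x] with ξ h1 h2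
  rw [h1, h2]
  by_cases h : ξ ∈ Metric.ball (0 : Space d) R
  · simp only [Set.indicator_of_mem h, smul_eq_mul]
    rw [← Complex.exp_conj, map_mul, Complex.conj_ofReal, Complex.conj_I]
    congr 2
    push_cast
    ring
  · simp [Set.indicator_of_notMem h]

theorem norm_sq_le_planeWave_add (R : ℝ) (u : L2 d) :
    ∀ᵐ x, ‖u x‖ ^ 2 ≤ 2 * ‖inner ℂ (planeWave R x) (𝓕 u : L2 d)‖ ^ 2 +
      2 * ‖(𝓕⁻ (highPart R (𝓕 u)) : L2 d) x‖ ^ 2 := by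
  have h : u = 𝓕⁻ (lowPart R (𝓕 u)) + 𝓕⁻ (highPart R (𝓕 u)) := by
    rw [← FourierTransform.fourierInv_add, lowPart_add_highPart,
      FourierTransform.fourierInv_fourier_eq]
  filter_upwards [fourierInv_lowPart R (𝓕 u), Lp.coeFn_add (𝓕⁻ (lowPart R (𝓕 u)))
    (𝓕⁻ (highPart R (𝓕 u)))] with x h1 h2
  rw [← h] at h2
  rw [h2, Pi.add_apply, h1]
  have := norm_add_le (inner ℂ (planeWave R x) (𝓕 u : L2 d)) ((𝓕⁻ (highPart R (𝓕 u)) : L2 d) x)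
  have h0 := norm_nonneg (inner ℂ (planeWave R x) (𝓕 u : L2 d) + (𝓕⁻ (highPart R (𝓕 u)) : L2 d) x)
  nlinarith [sq_nonneg (‖inner ℂ (planeWave R x) (𝓕 u : L2 d)‖ -
    ‖(𝓕⁻ (highPart R (𝓕 u)) : L2 d) x‖)]

theorem norm_fourierInv (f : L2 d) : ‖(𝓕⁻ f : L2 d)‖ = ‖f‖ := by
  rw [← Lp.norm_fourier_eq, FourierTransform.fourier_fourierInv_eq]

/-- Outside the ball of radius R the kinetic symbol 4π²‖ξ‖² is at least 4π²R². -/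
theorem norm_highPart_fourier_sq_le {R : ℝ} (hR : 0 ≤ R) (u : H1 d) :
    4 * Real.pi ^ 2 * R ^ 2 * ‖highPart R (𝓕 (u : L2 d))‖ ^ 2 ≤ gradSq u := by
  rw [← ENNReal.ofReal_le_ofReal_iff (gradSq_nonneg u), ENNReal.ofReal_mul (by positivity),
    norm_highPart_sq, gradSq_eq_lintegral, ← lintegral_const_mul']
  · refine (setLIntegral_mono_ae' measurableSet_ball.compl ?_).trans
      (setLIntegral_le_lintegral _ _)
    refine ae_of_all _ fun ξ hξ => ?_
    rw [← ENNReal.ofReal_mul (by positivity)]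
    have : R ≤ ‖ξ‖ := by simpa using hξ
    gcongr
  · exact ENNReal.ofReal_ne_top

/-! ### Rumin's proof of the orthonormal inequality with some constant -/

/-- The density `∑ₙ |uₙ|²` of a family of `L²` functions. -/
def density {N : ℕ} (u : Fin N → L2 d) (x : Space d) : ℝ := ∑ n, ‖u n x‖ ^ 2

theorem density_nonneg {N : ℕ} (u : Fin N → L2 d) (x : Space d) : 0 ≤ density u x :=
  Finset.sum_nonneg fun _ _ => by positivity

theorem measurable_density {N : ℕ} (u : Fin N → L2 d) : Measurable (density u) :=
  Finset.measurable_fun_sum _ fun n _ => ((Lp.stronglyMeasurable (u n)).measurable.norm.pow_const 2)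

/-- With b the volume of the ball, ρ ≤ 2b + 2·(high-frequency density). On the set where 4b ≤ ρ the
first term is at most ρ/2 and is absorbed on the left. The bound is independent of N thanks to
orthonormality. -/
theorem setLIntegral_density_le {N : ℕ} {u : Fin N → L2 d} (hu : Orthonormal ℂ u) (R : ℝ) :
    ∫⁻ x in {x | 4 * volume.real (Metric.ball (0 : Space d) R) ≤ density u x},
        ENNReal.ofReal (density u x) ≤
      4 * ∑ n, ENNReal.ofReal (‖highPart R (𝓕 (u n))‖ ^ 2) := by
  have hFu : Orthonormal ℂ fun n => (𝓕 (u n) : L2 d) :=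
    hu.comp_linearIsometry (Lp.fourierTransformₗᵢ (Space d) ℂ).toLinearIsometry
  have hpt : ∀ᵐ x, 4 * volume.real (Metric.ball (0 : Space d) R) ≤ density u x →
      density u x ≤ 4 * ∑ n, ‖(𝓕⁻ (highPart R (𝓕 (u n))) : L2 d) x‖ ^ 2 := by
    filter_upwards [ae_all_iff.2 fun n => norm_sq_le_planeWave_add R (u n)] with x hx hle
    have h1 : density u x ≤ ∑ n, (2 * ‖inner ℂ (planeWave R x) (𝓕 (u n) : L2 d)‖ ^ 2 +
      2 * ‖(𝓕⁻ (highPart R (𝓕 (u n))) : L2 d) x‖ ^ 2) := Finset.sum_le_sum fun n _ => hx n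
    -- Bessel for the orthonormal transforms: the low-frequency density at x is at most ‖`planeWave
    -- R x`‖², the volume of the ball.
    have h2 := hFu.sum_inner_products_le (planeWave R x) (s := Finset.univ)
    rw [norm_planeWave_sq] at h2
    simp_rw [norm_inner_symm _ (planeWave R x)] at h2
    rw [Finset.sum_add_distrib, ← Finset.mul_sum, ← Finset.mul_sum] at h1
    linarith
  have hms : MeasurableSet {x | 4 * volume.real (Metric.ball (0 : Space d) R) ≤ density u x} :=
    measurableSet_le measurable_const (measurable_density u)
  calc _ ≤ ∫⁻ x in {x | 4 * volume.real (Metric.ball (0 : Space d) R) ≤ density u x},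
        4 * ∑ n, ENNReal.ofReal (‖(𝓕⁻ (highPart R (𝓕 (u n))) : L2 d) x‖ ^ 2) := by
        refine setLIntegral_mono_ae' hms ?_
        filter_upwards [hpt] with x hx hmem
        refine (ENNReal.ofReal_le_ofReal (hx hmem)).trans_eq ?_
        rw [ENNReal.ofReal_mul (by norm_num), ENNReal.ofReal_sum_of_nonneg fun _ _ => by positivity]
        norm_num
    _ ≤ ∫⁻ x, 4 * ∑ n, ENNReal.ofReal (‖(𝓕⁻ (highPart R (𝓕 (u n))) : L2 d) x‖ ^ 2) :=
        setLIntegral_le_lintegral _ _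
    _ = _ := by
        rw [lintegral_const_mul' _ _ (by norm_num), lintegral_finsetSum']
        · simp_rw [← ofReal_norm_sq_eq_lintegral, norm_fourierInv]
        · intro i _
          exact ((Lp.aestronglyMeasurable _).norm.pow 2).aemeasurable.ennreal_ofReal

theorem measurableSet_le_norm_sq : MeasurableSet {p : ℝ × Space d | p.1 ≤ ‖p.2‖ ^ 2} :=
  measurableSet_le (by fun_prop) (by fun_prop)

theorem measurable_indicator_norm_sq (f : L2 d) :
    Measurable fun p : ℝ × Space d =>
      {p : ℝ × Space d | p.1 ≤ ‖p.2‖ ^ 2}.indicator (fun p => ENNReal.ofReal (‖f p.2‖ ^ 2)) p :=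
  Measurable.indicator ((((Lp.stronglyMeasurable f).measurable.comp measurable_snd).norm.pow_const
    2).ennreal_ofReal) measurableSet_le_norm_sq

theorem norm_highPart_sqrt_sq (t : ℝ) (f : L2 d) :
    ENNReal.ofReal (‖highPart (Real.sqrt t) f‖ ^ 2) = ∫⁻ ξ,
      {p : ℝ × Space d | p.1 ≤ ‖p.2‖ ^ 2}.indicator (fun p => ENNReal.ofReal (‖f p.2‖ ^ 2))
        (t, ξ) := by
  rw [norm_highPart_sq, ← lintegral_indicator measurableSet_ball.compl]
  refine lintegral_congr fun ξ => ?_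
  have : ξ ∈ (Metric.ball (0 : Space d) (Real.sqrt t))ᶜ ↔ t ≤ ‖ξ‖ ^ 2 := by
    simp [Real.sqrt_le_left (norm_nonneg _)]
  by_cases h : t ≤ ‖ξ‖ ^ 2
  · rw [Set.indicator_of_mem (this.2 h), Set.indicator_of_mem (by exact h)]
  · rw [Set.indicator_of_notMem (fun h' => h (this.1 h')), Set.indicator_of_notMem (by exact h)]

theorem aemeasurable_highPart_sqrt (f : L2 d) :
    AEMeasurable (fun t => ENNReal.ofReal (‖highPart (Real.sqrt t) f‖ ^ 2))
      (volume.restrict (Set.Ioi 0)) := by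
  refine AEMeasurable.congr (f := fun t => ∫⁻ ξ,
      {p : ℝ × Space d | p.1 ≤ ‖p.2‖ ^ 2}.indicator (fun p => ENNReal.ofReal (‖f p.2‖ ^ 2))
        (t, ξ)) ?_ ?_
  · exact ((measurable_indicator_norm_sq f).lintegral_prod_right').aemeasurable
  · filter_upwards [ae_restrict_mem measurableSet_Ioi] with t ht
    exact (norm_highPart_sqrt_sq t f).symm

/-- Layer-cake representation of the kinetic energy. -/
theorem gradSq_eq_lintegral_highPart (u : H1 d) :
    ENNReal.ofReal (gradSq u) = ENNReal.ofReal (4 * Real.pi ^ 2) *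
      ∫⁻ t in Set.Ioi (0 : ℝ), ENNReal.ofReal (‖highPart (Real.sqrt t) (𝓕 (u : L2 d))‖ ^ 2) := by
  have h1 : ∫⁻ t in Set.Ioi (0 : ℝ),
      ENNReal.ofReal (‖highPart (Real.sqrt t) (𝓕 (u : L2 d))‖ ^ 2) =
      ∫⁻ t in Set.Ioi (0 : ℝ), ∫⁻ ξ, {p : ℝ × Space d | p.1 ≤ ‖p.2‖ ^ 2}.indicator
        (fun p => ENNReal.ofReal (‖(𝓕 (u : L2 d) : L2 d) p.2‖ ^ 2)) (t, ξ) :=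
    setLIntegral_congr_fun measurableSet_Ioi fun t _ => norm_highPart_sqrt_sq t _
  rw [h1, lintegral_lintegral_swap
    (measurable_indicator_norm_sq (𝓕 (u : L2 d) : L2 d)).aemeasurable, gradSq_eq_lintegral,
    ← lintegral_const_mul' _ _ ENNReal.ofReal_ne_top]
  refine lintegral_congr fun ξ => ?_
  -- For fixed ξ the integrand is constant in t on (0, ‖ξ‖²] and zero beyond, so the t-integral
  -- produces the factor ‖ξ‖².
  have h2 : ∀ t : ℝ, {p : ℝ × Space d | p.1 ≤ ‖p.2‖ ^ 2}.indicator
        (fun p => ENNReal.ofReal (‖(𝓕 (u : L2 d) : L2 d) p.2‖ ^ 2)) (t, ξ) =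
      (Set.Iic (‖ξ‖ ^ 2)).indicator
        (fun _ => ENNReal.ofReal (‖(𝓕 (u : L2 d) : L2 d) ξ‖ ^ 2)) t := fun t => rfl
  simp_rw [h2]
  rw [lintegral_indicator measurableSet_Iic, setLIntegral_const,
    Measure.restrict_apply measurableSet_Iic, Set.Iic_inter_Ioi, Real.volume_Ioc, sub_zero,
    mul_comm (ENNReal.ofReal _) (ENNReal.ofReal (‖ξ‖ ^ 2)), ← ENNReal.ofReal_mul (by positivity),
    ← ENNReal.ofReal_mul (by positivity), mul_assoc (4 * Real.pi ^ 2)]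

theorem volume_real_ball_sqrt (hd : 1 ≤ d) {t : ℝ} (ht : 0 ≤ t) :
    volume.real (Metric.ball (0 : Space d) (Real.sqrt t)) =
      t ^ (d / 2 : ℝ) * volume.real (Metric.ball (0 : Space d) 1) := by
  have : Nonempty (Fin d) := ⟨⟨0, hd⟩⟩
  rw [measureReal_def, Measure.addHaar_ball _ _ (Real.sqrt_nonneg t), ENNReal.toReal_mul,
    ENNReal.toReal_ofReal (by positivity), ← measureReal_def, finrank_euclideanSpace,
    Fintype.card_fin, Real.sqrt_eq_rpow, ← Real.rpow_natCast, ← Real.rpow_mul ht]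
  congr 2
  ring

theorem volume_real_ball_one_pos : 0 < volume.real (Metric.ball (0 : Space d) 1) :=
  ENNReal.toReal_pos (Metric.measure_ball_pos _ _ one_pos).ne' measure_ball_lt_top.ne

/-- The ball of radius √t has volume ωt^(d/2), with ω the volume of the unit ball, so the set
contains (0, T] for T = (r/4ω)^(2/d). -/
theorem ofReal_rpow_le_lintegral_indicator (hd : 1 ≤ d) {r : ℝ} (hr : 0 ≤ r) :
    ENNReal.ofReal ((r / (4 * volume.real (Metric.ball (0 : Space d) 1))) ^ (2 / d : ℝ)) ≤
      ∫⁻ t in Set.Ioi (0 : ℝ), {t | 4 * volume.real (Metric.ball (0 : Space d) (Real.sqrt t)) ≤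
        r}.indicator 1 t := by
  have hd0 : (0 : ℝ) < d := by exact_mod_cast hd
  set ω := volume.real (Metric.ball (0 : Space d) 1) with hω
  have hω0 : 0 < ω := volume_real_ball_one_pos
  set T := (r / (4 * ω)) ^ (2 / d : ℝ)
  calc ENNReal.ofReal T = ∫⁻ t in Set.Ioi (0 : ℝ), (Set.Ioc 0 T).indicator 1 t := by
        rw [lintegral_indicator_one measurableSet_Ioc, Measure.restrict_apply measurableSet_Ioc,
          Set.inter_eq_left.2 Set.Ioc_subset_Ioi_self, Real.volume_Ioc, sub_zero]
    _ ≤ _ := by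
        refine lintegral_mono fun t => ?_
        refine Set.indicator_le_indicator_of_subset (fun t ht => ?_) (fun _ => zero_le) t
        simp only [Set.mem_ofPred_eq]
        rw [volume_real_ball_sqrt hd ht.1.le]
        have : t ^ (d / 2 : ℝ) ≤ r / (4 * ω) := by
          refine (Real.rpow_le_rpow ht.1.le ht.2 (by positivity)).trans_eq ?_
          rw [← Real.rpow_mul (by positivity)]
          have : (2 / d * (d / 2) : ℝ) = 1 := by field_simp
          rw [this, Real.rpow_one]
        rw [le_div_iff₀ (by positivity)] at this
        linarith

/-- The Lieb–Thirring inequality for orthonormal functions holds with some positive constant. -/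
theorem exists_orthonormalLT (hd : 1 ≤ d) : ∃ K : ℝ≥0, 0 < K ∧ OrthonormalLT d K := by
  have hd0 : (0 : ℝ) < d := by exact_mod_cast hd
  set ω := volume.real (Metric.ball (0 : Space d) 1) with hω
  have hω0 : 0 < ω := volume_real_ball_one_pos
  -- The constant: 4π² from the layer-cake formula divided by the 4 of `setLIntegral_density_le`,
  -- times (4ω)^(-2/d) from the length of the t-interval.
  have hK : 0 < Real.pi ^ 2 * (1 / (4 * ω)) ^ (2 / d : ℝ) := by positivity
  refine ⟨(Real.pi ^ 2 * (1 / (4 * ω)) ^ (2 / d : ℝ)).toNNReal, Real.toNNReal_pos.2 hK,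
    fun N u hu => ?_⟩
  set ρ := density fun n => (u n : L2 d) with hρ
  have hρm : Measurable ρ := measurable_density _
  simp_rw [lintegral_weakPartial_sq, gradSq_eq_lintegral_highPart]
  rw [← Finset.mul_sum, ← lintegral_finsetSum' _ fun n _ => aemeasurable_highPart_sqrt _]
  have hS : MeasurableSet {p : ℝ × Space d |
      4 * volume.real (Metric.ball (0 : Space d) (Real.sqrt p.1)) ≤ ρ p.2} := by
    refine measurableSet_le ?_ (hρm.comp measurable_snd)
    have hmono : Monotone fun t : ℝ => 4 * volume.real (Metric.ball (0 : Space d) (Real.sqrt t)) :=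
      fun s t hst => by
        have := measureReal_mono (μ := volume) (Metric.ball_subset_ball (x := (0 : Space d))
          (Real.sqrt_le_sqrt hst)) measure_ball_lt_top.ne
        simpa using this
    exact hmono.measurable.comp measurable_fst
  have hF : Measurable fun p : ℝ × Space d => {p : ℝ × Space d |
      4 * volume.real (Metric.ball (0 : Space d) (Real.sqrt p.1)) ≤ ρ p.2}.indicator
        (fun p => ENNReal.ofReal (ρ p.2)) p :=
    Measurable.indicator (hρm.comp measurable_snd).ennreal_ofReal hS
  calc _ = ENNReal.ofReal (Real.pi ^ 2) * ∫⁻ x, ENNReal.ofReal (ρ x) *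
        ENNReal.ofReal ((ρ x / (4 * ω)) ^ (2 / d : ℝ)) := by
        rw [← lintegral_const_mul' _ _ ENNReal.ofReal_ne_top,
          ← lintegral_const_mul' _ _ ENNReal.coe_ne_top]
        refine lintegral_congr fun x => ?_
        have h0 : 0 ≤ ρ x := density_nonneg _ x
        rw [← ENNReal.ofReal_mul h0, ← ENNReal.ofReal_mul (by positivity),
          ← ENNReal.ofReal, ← ENNReal.ofReal_mul hK.le]
        congr 1
        change _ * (ρ x) ^ (1 + 2 / d : ℝ) = _
        rw [Real.rpow_one_add' h0 (by positivity), div_eq_mul_one_div (ρ x),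
          Real.mul_rpow h0 (by positivity)]
        ring
    _ ≤ ENNReal.ofReal (Real.pi ^ 2) * ∫⁻ x, ∫⁻ t in Set.Ioi (0 : ℝ), {p : ℝ × Space d |
      4 * volume.real (Metric.ball (0 : Space d) (Real.sqrt p.1)) ≤ ρ p.2}.indicator
        (fun p => ENNReal.ofReal (ρ p.2)) (t, x) := by
        gcongr with x
        refine (mul_le_mul_right (ofReal_rpow_le_lintegral_indicator hd
          (density_nonneg _ x)) _).trans_eq ?_
        rw [← lintegral_const_mul' _ _ ENNReal.ofReal_ne_top]
        refine lintegral_congr fun t => ?_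
        simp only [Set.indicator_apply, Set.mem_ofPred_eq, Pi.one_apply, mul_ite, mul_one, mul_zero]
        rfl
    _ = ENNReal.ofReal (Real.pi ^ 2) * ∫⁻ t in Set.Ioi (0 : ℝ), ∫⁻ x,  {p : ℝ × Space d |
      4 * volume.real (Metric.ball (0 : Space d) (Real.sqrt p.1)) ≤ ρ p.2}.indicator
        (fun p => ENNReal.ofReal (ρ p.2)) (t, x) := by
        rw [lintegral_lintegral_swap]
        exact (hF.comp measurable_swap).aemeasurable
    _ ≤ ENNReal.ofReal (Real.pi ^ 2) * ∫⁻ t in Set.Ioi (0 : ℝ),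
        4 * ∑ n, ENNReal.ofReal (‖highPart (Real.sqrt t) (𝓕 (u n : L2 d))‖ ^ 2) := by
        gcongr with t
        refine le_trans (le_of_eq ?_) (setLIntegral_density_le hu (Real.sqrt t))
        rw [← lintegral_indicator (measurableSet_le measurable_const hρm)]
        rfl
    _ = _ := by
        rw [lintegral_const_mul' _ _ (by norm_num), ← mul_assoc, mul_comm (ENNReal.ofReal _),
          mul_comm 4 (Real.pi ^ 2), ENNReal.ofReal_mul (by positivity), mul_comm 4]
        norm_num

/-! ### Eigenfunctions and the sum of negative eigenvalues -/

/-- `φ` is an eigenfunction (or zero) of `-Δ + V` with eigenvalue `E`, in the form sense. -/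
def IsEigen (V : Space d → ℝ) (E : ℝ) (φ : H1 d) : Prop :=
  ∀ v : H1 d, Integrable (potentialIntegrand V v φ) ∧
    schrodingerForm V v φ = (E : ℂ) * inner ℂ (v : L2 d) (φ : L2 d)

theorem schrodingerForm_conj (V : Space d → ℝ) (u v : H1 d) :
    conj (schrodingerForm V u v) = schrodingerForm V v u := by
  rw [schrodingerForm, schrodingerForm, map_add, map_sum, ← integral_conj]
  congr 1
  · exact Finset.sum_congr rfl fun i _ => inner_conj_symm _ _
  · refine integral_congr_ae (ae_of_all _ fun x => ?_)
    simp [potentialIntegrand, mul_comm]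

theorem IsEigen.inner_eq_zero {V : Space d → ℝ} {E F : ℝ} {φ ψ : H1 d} (hφ : IsEigen V E φ)
    (hψ : IsEigen V F ψ) (h : E ≠ F) : inner ℂ (φ : L2 d) (ψ : L2 d) = 0 := by
  have h1 := (hψ φ).2
  have h2 := (hφ ψ).2
  rw [← schrodingerForm_conj, h1, map_mul, Complex.conj_ofReal, inner_conj_symm] at h2
  have h3 : ((F : ℂ) - E) * inner ℂ (ψ : L2 d) (φ : L2 d) = 0 := by rw [sub_mul, h2, sub_self]
  rcases mul_eq_zero.1 h3 with h4 | h4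
  · exact absurd (Complex.ofReal_injective (sub_eq_zero.1 h4)).symm h
  · rw [← inner_conj_symm, h4, map_zero]

/-- The eigenspace of `-Δ + V` for the eigenvalue `E`, as a subspace of `L²`. -/
def eigenspace (V : Space d → ℝ) (E : ℝ) : Submodule ℂ (L2 d) :=
  (schrodingerGraph V).comap (LinearMap.prod LinearMap.id ((E : ℂ) • LinearMap.id))

theorem mem_eigenspace {V : Space d → ℝ} {E : ℝ} {f : L2 d} :
    f ∈ eigenspace V E ↔ ∃ φ : H1 d, (φ : L2 d) = f ∧ IsEigen V E φ := by
  constructor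
  · rintro ⟨φ, h1, h2⟩
    have h1 : (φ : L2 d) = f := h1
    refine ⟨φ, h1, fun v => ⟨(h2 v).1, (h2 v).2.trans ?_⟩⟩
    subst h1
    exact inner_smul_right _ _ _
  · rintro ⟨φ, rfl, h⟩
    exact ⟨φ, rfl, fun v => ⟨(h v).1, (h v).2.trans (inner_smul_right _ _ _).symm⟩⟩

/-- The kernel lives in the operator domain; its image under the inclusion into L² is described by
the graph alone. -/
theorem rank_ker_eq_rank_eigenspace (V : Space d → ℝ) (E : ℝ) :
    Module.rank ℂ (LinearMap.ker ((schrodingerOperator V).toFun -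
      (E : ℂ) • (schrodingerOperator V).domain.subtype)) = Module.rank ℂ (eigenspace V E) := by
  have h : eigenspace V E = (LinearMap.ker ((schrodingerOperator V).toFun -
      (E : ℂ) • (schrodingerOperator V).domain.subtype)).map
        (schrodingerOperator V).domain.subtype := by
    ext f
    rw [Submodule.mem_map]
    change (f, (E : ℂ) • f) ∈ schrodingerGraph V ↔ _
    rw [← graph_schrodingerOperator, LinearPMap.mem_graph_iff]
    constructor
    · rintro ⟨y, rfl, hy⟩
      refine ⟨y, ?_, rfl⟩
      rw [LinearMap.mem_ker, LinearMap.sub_apply, sub_eq_zero]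
      exact hy
    · rintro ⟨y, hy, rfl⟩
      rw [LinearMap.mem_ker, LinearMap.sub_apply, sub_eq_zero] at hy
      exact ⟨y, rfl, hy⟩
  rw [h]
  exact (LinearEquiv.rank_eq
    (Submodule.equivMapOfInjective _ (Submodule.injective_subtype _) _))

theorem natCast_le_eigenMultiplicity_iff {V : Space d → ℝ} {E : ℝ} {n : ℕ} :
    (n : ℕ∞) ≤ eigenMultiplicity (schrodingerOperator V) E ↔
      (n : Cardinal) ≤ Module.rank ℂ (eigenspace V E) := by
  rw [eigenMultiplicity, rank_ker_eq_rank_eigenspace, Cardinal.natCast_le_toENat]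

theorem card_le_eigenMultiplicity {ι : Type} [Fintype ι] {V : Space d → ℝ} {E : ℝ} {φ : ι → H1 d}
    (hφ : Orthonormal ℂ fun i => (φ i : L2 d)) (h : ∀ i, IsEigen V E (φ i)) :
    (Fintype.card ι : ℕ∞) ≤ eigenMultiplicity (schrodingerOperator V) E := by
  rw [natCast_le_eigenMultiplicity_iff]
  have hli : LinearIndependent ℂ fun i =>
      (⟨φ i, mem_eigenspace.2 ⟨φ i, rfl, h i⟩⟩ : eigenspace V E) :=
    LinearIndependent.of_comp (eigenspace V E).subtype hφ.linearIndependent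
  simpa using hli.cardinal_le_rank

theorem exists_orthonormal_eigen {V : Space d → ℝ} {E : ℝ} {n : ℕ}
    (hn : (n : ℕ∞) ≤ eigenMultiplicity (schrodingerOperator V) E) :
    ∃ φ : Fin n → H1 d, (Orthonormal ℂ fun i => (φ i : L2 d)) ∧ ∀ i, IsEigen V E (φ i) := by
  rw [natCast_le_eigenMultiplicity_iff] at hn
  obtain ⟨f, hf⟩ := (Module.le_rank_iff_exists_linearMap).1 hn
  let g : (Fin n → ℂ) →ₗ[ℂ] L2 d := (eigenspace V E).subtype ∘ₗ f
  have hg : Function.Injective g := (Submodule.injective_subtype _).comp hf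
  have hfr : Module.finrank ℂ (LinearMap.range g) = n := by
    rw [LinearMap.finrank_range_of_inj hg]; simp
  let b := (stdOrthonormalBasis ℂ (LinearMap.range g)).reindex (finCongr hfr)
  have hb : ∀ i, (b i : L2 d) ∈ eigenspace V E := fun i => by
    obtain ⟨x, hx⟩ := (b i).2
    rw [← hx]
    exact (f x).2
  choose φ h1 h2 using fun i => mem_eigenspace.1 (hb i)
  refine ⟨φ, ?_, h2⟩
  simp_rw [h1]
  exact b.orthonormal.comp_linearIsometry (LinearMap.range g).subtypeₗᵢ

/-- Every finite orthonormal family of eigenfunctions with negative eigenvalues is counted in the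
sum of the negative eigenvalues. -/
theorem sum_le_sumAbsNegEigenvalues {ι : Type} [Fintype ι] {V : Space d → ℝ} {φ : ι → H1 d}
    {E : ι → ℝ} (hφ : Orthonormal ℂ fun i => (φ i : L2 d)) (h : ∀ i, IsEigen V (E i) (φ i))
    (hE : ∀ i, E i < 0) :
    ∑ i, ENNReal.ofReal |E i| ≤ sumAbsNegEigenvalues (schrodingerOperator V) := by
  classical
  let E' : ι → Set.Iio (0 : ℝ) := fun i => ⟨E i, hE i⟩
  have h1 : ∑ i, ENNReal.ofReal |E i| = ∑ e ∈ Finset.univ.image E',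
      (Finset.univ.filter fun i => E' i = e).card • ENNReal.ofReal |(e : ℝ)| :=
    Finset.sum_comp (fun e : Set.Iio (0 : ℝ) => ENNReal.ofReal |(e : ℝ)|) E'
  rw [h1]
  refine le_trans (Finset.sum_le_sum fun e _ => ?_) (ENNReal.sum_le_tsum _)
  rw [nsmul_eq_mul]
  gcongr
  have h2 := card_le_eigenMultiplicity (ι := {i // E' i = e}) (V := V) (E := e)
    (φ := fun i => φ i) (hφ.comp _ Subtype.val_injective) (fun i => by
      have := h i
      rwa [show E i = (e : ℝ) from congrArg Subtype.val i.2] at this)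
  rw [Fintype.card_subtype] at h2
  exact_mod_cast ENat.toENNReal_le.2 h2

/-- The sum of the negative eigenvalues is bounded as soon as all finite orthonormal families of
eigenfunctions obey the bound. -/
theorem sumAbsNegEigenvalues_le {V : Space d → ℝ} {B : ℝ≥0∞}
    (hB : ∀ (ι : Type) [Fintype ι] (φ : ι → H1 d) (E : ι → ℝ),
      (Orthonormal ℂ fun i => (φ i : L2 d)) → (∀ i, IsEigen V (E i) (φ i)) → (∀ i, E i < 0) →
        ∑ i, ENNReal.ofReal |E i| ≤ B) :
    sumAbsNegEigenvalues (schrodingerOperator V) ≤ B := by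
  classical
  rw [sumAbsNegEigenvalues, ENNReal.tsum_eq_iSup_sum]
  refine iSup_le fun s => ?_
  -- A multiplicity could be `⊤`, so all are truncated at k, which yields finite orthonormal
  -- families, and then k → ∞.
  have hlim : Tendsto (fun k : ℕ => ∑ e ∈ s, min ((eigenMultiplicity (schrodingerOperator V) e :
      ℕ∞) : ℝ≥0∞) (k : ℝ≥0∞) * ENNReal.ofReal |(e : ℝ)|) atTop
      (𝓝 (∑ e ∈ s, ((eigenMultiplicity (schrodingerOperator V) e : ℕ∞) : ℝ≥0∞) *
        ENNReal.ofReal |(e : ℝ)|)) := by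
    refine tendsto_finsetSum _ fun e _ => ?_
    refine ENNReal.Tendsto.mul_const ?_ (Or.inr ENNReal.ofReal_ne_top)
    simpa using (tendsto_const_nhds (x := ((eigenMultiplicity (schrodingerOperator V) e : ℕ∞) :
      ℝ≥0∞))).min ENNReal.tendsto_nat_nhds_top
  refine le_of_tendsto' hlim fun k => ?_
  have hex : ∀ e : s, ∃ n : ℕ, (n : ℕ∞) = min (eigenMultiplicity (schrodingerOperator V)
      (e : Set.Iio (0 : ℝ))) k := fun e =>
    ENat.ne_top_iff_exists.1 (ne_top_of_le_ne_top (ENat.natCast_ne_top k) (min_le_right _ _))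
  choose n hn using hex
  choose φ hφ hφE using fun e : s => exists_orthonormal_eigen (V := V)
    (E := (e : Set.Iio (0 : ℝ))) (n := n e) ((hn e).le.trans (min_le_left _ _))
  -- Families for different eigenvalues are orthogonal by symmetry of the form, so their union is
  -- orthonormal.
  have horth : Orthonormal ℂ fun i : (Σ e : s, Fin (n e)) => (φ i.1 i.2 : L2 d) := by
    refine ⟨fun i => (hφ i.1).1 i.2, ?_⟩
    rintro ⟨e, i⟩ ⟨f, j⟩ hne
    by_cases hef : e = f
    · subst hef
      exact (hφ e).2 fun hij => hne (congrArg (Sigma.mk e) hij)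
    · exact (hφE e i).inner_eq_zero (hφE f j) fun h => hef (Subtype.ext (Subtype.ext h))
  have := hB (Σ e : s, Fin (n e)) (fun i => φ i.1 i.2) (fun i => (i.1 : Set.Iio (0 : ℝ))) horth
    (fun i => hφE i.1 i.2) (fun i => (i.1 : Set.Iio (0 : ℝ)).2)
  refine le_trans (le_of_eq ?_) this
  rw [Fintype.sum_sigma, ← Finset.sum_coe_sort s]
  refine Finset.sum_congr rfl fun e _ => ?_
  change _ = ∑ _y : Fin (n e), ENNReal.ofReal |((e : Set.Iio (0 : ℝ)) : ℝ)|
  rw [Finset.sum_const, Finset.card_univ, Fintype.card_fin, nsmul_eq_mul]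
  congr 1
  rw [← ENat.toENNReal_coe k, ← ENat.toENNReal_min, ← hn e, ENat.toENNReal_coe]

/-! ### Duality: from orthonormal functions to Schrödinger operators -/

/-- The relation between the dual constants of the two Lieb–Thirring inequalities. -/
def DualConstants (d : ℕ) (L K : ℝ≥0) : Prop :=
  ((1 + d / 2 : ℝ) * L) * ((1 + 2 / d : ℝ) * K) ^ (d / 2 : ℝ) = 1

theorem holderConjugate_exponents (hd : 1 ≤ d) :
    (1 + d / 2 : ℝ).HolderConjugate (1 + 2 / d : ℝ) := by
  have hd0 : (0 : ℝ) < d := by exact_mod_cast hd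
  rw [Real.holderConjugate_iff]
  constructor
  · linarith [half_pos hd0]
  · field_simp
    ring

theorem young_of_dualConstants (hd : 1 ≤ d) {L K : ℝ≥0} (hK : 0 < K) (h : DualConstants d L K)
    {v t : ℝ} (hv : 0 ≤ v) (ht : 0 ≤ t) :
    v * t ≤ L * v ^ (1 + d / 2 : ℝ) + K * t ^ (1 + 2 / d : ℝ) := by
  have hd0 : (0 : ℝ) < d := by exact_mod_cast hd
  set q : ℝ := 1 + 2 / d with hq
  set p : ℝ := 1 + d / 2 with hp
  have hq0 : 0 < q := by positivity
  have hp0 : 0 < p := by positivity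
  have hK' : (0 : ℝ) < K := hK
  -- Rescaling v ↦ v/c, t ↦ ct in Young's inequality with c^q = qK gives t^q the coefficient K.
  -- Since p/q = d/2, duality makes the coefficient of vᵖ equal to L.
  set c : ℝ := (q * K) ^ (1 / q) with hc
  have hc0 : 0 < c := by positivity
  have hcq : c ^ q = q * K := by
    rw [hc, ← Real.rpow_mul (by positivity), one_div_mul_cancel hq0.ne', Real.rpow_one]
  have hcp : c ^ p = (q * K) ^ (d / 2 : ℝ) := by
    rw [hc, ← Real.rpow_mul (by positivity)]
    congr 1
    rw [hq, hp]; field_simp; ring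
  have hy := Real.young_inequality_of_nonneg (a := v / c) (b := c * t) (by positivity)
    (by positivity) (holderConjugate_exponents hd)
  rw [← hq, ← hp, Real.div_rpow hv hc0.le, Real.mul_rpow hc0.le ht, hcq, hcp] at hy
  have e1 : v / c * (c * t) = v * t := by field_simp
  have e2 : q * K * t ^ q / q = K * t ^ q := by field_simp
  have e3 : v ^ p / (q * K) ^ (d / 2 : ℝ) / p = L * v ^ p := by
    have h' : p * L * (q * K) ^ (d / 2 : ℝ) = 1 := h
    have : 0 < (q * K) ^ (d / 2 : ℝ) := by positivity
    field_simp
    linear_combination (-v ^ p) * h'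
  rw [e1, e2, e3] at hy
  exact hy

theorem inner_weakPartial_self (u : H1 d) :
    ∑ i : Fin d, inner ℂ (weakPartial i u) (weakPartial i u) = (gradSq u : ℂ) := by
  rw [gradSq]
  push_cast
  exact Finset.sum_congr rfl fun i _ => inner_self_eq_norm_sq_to_K _

theorem potentialIntegrand_self (V : Space d → ℝ) (u : H1 d) (x : Space d) :
    potentialIntegrand V u u x = ((V x * ‖(u : L2 d) x‖ ^ 2 : ℝ) : ℂ) := by
  rw [potentialIntegrand, Complex.conj_mul']
  push_cast
  rfl

theorem schrodingerForm_self (V : Space d → ℝ) (u : H1 d) :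
    schrodingerForm V u u = ((gradSq u + ∫ x, V x * ‖(u : L2 d) x‖ ^ 2 : ℝ) : ℂ) := by
  rw [schrodingerForm, inner_weakPartial_self]
  simp_rw [potentialIntegrand_self]
  rw [integral_complex_ofReal]
  push_cast
  rfl

theorem IsEigen.integrable {V : Space d → ℝ} {E : ℝ} {φ : H1 d} (h : IsEigen V E φ) :
    Integrable fun x => V x * ‖(φ : L2 d) x‖ ^ 2 := by
  have := (h φ).1.re
  refine this.congr (ae_of_all _ fun x => ?_)
  simp only [potentialIntegrand_self]
  exact Complex.ofReal_re _

theorem IsEigen.energy_eq {V : Space d → ℝ} {E : ℝ} {φ : H1 d} (h : IsEigen V E φ)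
    (h1 : ‖(φ : L2 d)‖ = 1) : gradSq φ + ∫ x, V x * ‖(φ : L2 d) x‖ ^ 2 = E := by
  have := (h φ).2
  rw [schrodingerForm_self, inner_self_eq_norm_sq_to_K, h1] at this
  have h2 := congrArg Complex.re this
  simpa using h2

theorem OrthonormalLT.fintype {K : ℝ≥0} (h : OrthonormalLT d K) {ι : Type} [Fintype ι]
    (u : ι → H1 d) (hu : Orthonormal ℂ fun i => (u i : L2 d)) :
    K * ∫⁻ x, ENNReal.ofReal ((∑ i, ‖(u i : L2 d) x‖ ^ 2) ^ (1 + 2 / d : ℝ)) ≤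
      ENNReal.ofReal (∑ i, gradSq (u i)) := by
  let e := (Fintype.equivFin ι).symm
  have := h _ (fun n => u (e n)) (hu.comp e e.injective)
  simp_rw [lintegral_weakPartial_sq] at this
  rw [Equiv.sum_comp e fun i => ENNReal.ofReal (gradSq (u i)),
    ← ENNReal.ofReal_sum_of_nonneg fun _ _ => gradSq_nonneg _] at this
  refine le_trans (le_of_eq ?_) this
  congr 1
  refine lintegral_congr fun x => ?_
  rw [Equiv.sum_comp e fun i => ‖(u i : L2 d) x‖ ^ 2]

/-- Duality: the inequality for orthonormal functions implies the one for Schrödinger operators. -/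
theorem SchrodingerLT.of_orthonormalLT (hd : 1 ≤ d) {L K : ℝ≥0} (hK : 0 < K)
    (hLK : DualConstants d L K) (h : OrthonormalLT d K) : SchrodingerLT d L := by
  intro V hV
  refine sumAbsNegEigenvalues_le fun ι _ φ E hφ hφE hE => ?_
  have hE2 : ∑ i, |E i| + ∑ i, gradSq (φ i) = ∫ x, -V x * ∑ i, ‖(φ i : L2 d) x‖ ^ 2 := by
    have : ∀ x, -V x * ∑ i, ‖(φ i : L2 d) x‖ ^ 2 = ∑ i, -(V x * ‖(φ i : L2 d) x‖ ^ 2) := fun x => by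
      rw [Finset.mul_sum]; simp
    simp_rw [this]
    rw [integral_finsetSum _ fun i _ => by exact (hφE i).integrable.neg, ← Finset.sum_add_distrib]
    refine Finset.sum_congr rfl fun i _ => ?_
    rw [integral_neg, abs_of_neg (hE i), ← (hφE i).energy_eq (hφ.1 i)]
    ring
  have hint : Integrable fun x => -V x * ∑ i, ‖(φ i : L2 d) x‖ ^ 2 := by
    have := (integrable_finsetSum Finset.univ fun i _ => (hφE i).integrable).neg
    refine this.congr (ae_of_all _ fun x => ?_)
    simp [Finset.mul_sum]
  have hG := h.fintype φ hφ
  set G := ∑ i, gradSq (φ i)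
  have hG0 : 0 ≤ G := Finset.sum_nonneg fun i _ => gradSq_nonneg _
  -- The left side equals ∫ -Vρ. Young bounds it by L∫V₋ᵖ + K∫ρ^q, and the orthonormal inequality
  -- bounds the last term by the finite energy G, which then cancels.
  have key : ENNReal.ofReal (∑ i, |E i|) + ENNReal.ofReal G ≤
      L * (∫⁻ x, ENNReal.ofReal (max (-V x) 0 ^ (1 + d / 2 : ℝ))) + ENNReal.ofReal G := by
    rw [← ENNReal.ofReal_add (Finset.sum_nonneg fun _ _ => abs_nonneg _) hG0, hE2]
    have hmono : ∫ x, -V x * ∑ i, ‖(φ i : L2 d) x‖ ^ 2 ≤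
        ∫ x, max (-V x * ∑ i, ‖(φ i : L2 d) x‖ ^ 2) 0 :=
      integral_mono hint hint.pos_part fun x => le_max_left _ _
    refine (ENNReal.ofReal_le_ofReal hmono).trans ?_
    rw [ofReal_integral_eq_lintegral_ofReal hint.pos_part (ae_of_all _ fun x => le_max_right _ _)]
    have hm : Measurable fun x => ENNReal.ofReal
        ((∑ i, ‖(φ i : L2 d) x‖ ^ 2) ^ (1 + 2 / d : ℝ)) :=
      ((Finset.measurable_fun_sum _ fun i _ =>
        ((Lp.stronglyMeasurable (φ i : L2 d)).measurable.norm.pow_const 2)).pow_const _).ennreal_ofReal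
    calc _ ≤ ∫⁻ x, (L * ENNReal.ofReal (max (-V x) 0 ^ (1 + d / 2 : ℝ)) +
          K * ENNReal.ofReal ((∑ i, ‖(φ i : L2 d) x‖ ^ 2) ^ (1 + 2 / d : ℝ))) := by
          refine lintegral_mono fun x => ?_
          have hρ : 0 ≤ ∑ i, ‖(φ i : L2 d) x‖ ^ 2 := Finset.sum_nonneg fun _ _ => by positivity
          have hy := young_of_dualConstants hd hK hLK (le_max_right (-V x) 0) hρ
          rw [← ENNReal.ofReal_coe_nnreal, ← ENNReal.ofReal_coe_nnreal,
            ← ENNReal.ofReal_mul L.coe_nonneg, ← ENNReal.ofReal_mul K.coe_nonneg,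
            ← ENNReal.ofReal_add (by positivity) (by positivity)]
          refine ENNReal.ofReal_le_ofReal (le_trans ?_ hy)
          rw [max_mul_of_nonneg _ _ hρ, zero_mul]
      _ = L * (∫⁻ x, ENNReal.ofReal (max (-V x) 0 ^ (1 + d / 2 : ℝ))) +
          K * ∫⁻ x, ENNReal.ofReal ((∑ i, ‖(φ i : L2 d) x‖ ^ 2) ^ (1 + 2 / d : ℝ)) := by
          rw [lintegral_add_right _ (hm.const_mul _), lintegral_const_mul' _ _ ENNReal.coe_ne_top,
            lintegral_const_mul' _ _ ENNReal.coe_ne_top]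
      _ ≤ _ := by gcongr
  rw [← ENNReal.ofReal_sum_of_nonneg fun _ _ => abs_nonneg _]
  exact (ENNReal.add_le_add_iff_right ENNReal.ofReal_ne_top).1 key

/-! ### Cutoff potentials and compactness of the potential energy -/

/-- Bounded measurable nonnegative functions of bounded support. -/
structure IsCutoffWeight (W : Space d → ℝ) (M r : ℝ) : Prop where
  measurable : Measurable W
  nonneg : ∀ x, 0 ≤ W x
  le : ∀ x, W x ≤ M
  support : ∀ x, x ∉ Metric.closedBall (0 : Space d) r → W x = 0

namespace IsCutoffWeight

variable {W : Space d → ℝ} {M r : ℝ}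

theorem bound_nonneg (hW : IsCutoffWeight W M r) : 0 ≤ M := (hW.nonneg 0).trans (hW.le 0)

theorem memLp (hW : IsCutoffWeight W M r) (p : ℝ≥0∞) : MemLp W p volume := by
  have h : W = (Metric.closedBall (0 : Space d) r).indicator W := by
    ext x
    by_cases hx : x ∈ Metric.closedBall (0 : Space d) r
    · rw [Set.indicator_of_mem hx]
    · rw [Set.indicator_of_notMem hx, hW.support x hx]
  have : IsFiniteMeasure (volume.restrict (Metric.closedBall (0 : Space d) r)) :=
    ⟨by simpa using measure_closedBall_lt_top⟩
  rw [h, memLp_indicator_iff_restrict measurableSet_closedBall]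
  refine MemLp.of_bound hW.measurable.aestronglyMeasurable M (ae_of_all _ fun x => ?_)
  rw [Real.norm_of_nonneg (hW.nonneg x)]
  exact hW.le x

theorem integrable (hW : IsCutoffWeight W M r) : Integrable W :=
  memLp_one_iff_integrable.1 (hW.memLp 1)

theorem integrable_mul (hW : IsCutoffWeight W M r) {f : Space d → ℝ} (hf : Integrable f) :
    Integrable fun x => W x * f x :=
  hf.bdd_mul hW.measurable.aestronglyMeasurable
    (ae_of_all _ fun x => (Real.norm_of_nonneg (hW.nonneg x)).trans_le (hW.le x))

theorem integrable_potentialIntegrand (hW : IsCutoffWeight W M r) (v u : H1 d) :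
    Integrable (potentialIntegrand (-W) v u) := by
  have h : Integrable fun x => conj ((v : L2 d) x) * (u : L2 d) x := by
    refine (L2.integrable_inner (𝕜 := ℂ) (v : L2 d) (u : L2 d)).congr (ae_of_all _ fun x => ?_)
    simp [mul_comm]
  refine h.bdd_mul (c := M) ?_ (ae_of_all _ fun x => ?_)
  · exact (Complex.measurable_ofReal.comp hW.measurable.neg).aestronglyMeasurable
  · rw [Complex.norm_real, Pi.neg_apply, norm_neg, Real.norm_of_nonneg (hW.nonneg x)]
    exact hW.le x

theorem integral_mul_norm_sq_le (hW : IsCutoffWeight W M r) (u : L2 d) :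
    ∫ x, W x * ‖u x‖ ^ 2 ≤ M * ‖u‖ ^ 2 := by
  rw [norm_sq_eq_integral, ← integral_const_mul]
  refine integral_mono (hW.integrable_mul (integrable_norm_sq u))
    ((integrable_norm_sq u).const_mul M) fun x => ?_
  exact mul_le_mul_of_nonneg_right (hW.le x) (by positivity)

theorem integral_mul_norm_sq_nonneg (hW : IsCutoffWeight W M r) (u : L2 d) :
    0 ≤ ∫ x, W x * ‖u x‖ ^ 2 :=
  integral_nonneg fun x => mul_nonneg (hW.nonneg x) (by positivity)

/-- The potential energy is compact relative to the `H¹` norm: up to an arbitrarily small multiple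
of the `H¹` norm, it is controlled by finitely many functionals. -/
theorem exists_finset_integral_le (hW : IsCutoffWeight W M r) {ε : ℝ} (hε : 0 < ε) :
    ∃ (s : Finset (L2 d)) (C : ℝ), 0 ≤ C ∧ ∀ u : H1 d,
      ∫ x, W x * ‖(u : L2 d) x‖ ^ 2 ≤ ε * (gradSq u + ‖(u : L2 d)‖ ^ 2) +
        C * ∑ h ∈ s, ‖inner ℂ h (𝓕 (u : L2 d) : L2 d)‖ ^ 2 := by
  have hM := hW.bound_nonneg
  set I := ∫ x, W x with hI
  have hI0 : 0 ≤ I := integral_nonneg hW.nonneg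
  -- R is large enough for the high frequencies to contribute at most ε times the kinetic energy;
  -- the `+ 1` keeps it positive.
  set R := Real.sqrt (M / ε) + 1 with hR
  have hR0 : 0 < R := by positivity
  have hMR : 2 * M ≤ ε * (4 * Real.pi ^ 2 * R ^ 2) := by
    have h1 : M / ε ≤ R ^ 2 := by
      have := Real.sq_sqrt (show 0 ≤ M / ε by positivity)
      nlinarith [Real.sqrt_nonneg (M / ε)]
    rw [div_le_iff₀ hε] at h1
    have h2 : (1 : ℝ) ≤ Real.pi ^ 2 := by nlinarith [Real.pi_gt_three]
    nlinarith [mul_nonneg hε.le (sq_nonneg R)]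
  set δ := Real.sqrt (ε / (4 * I + 1)) with hδ
  have hδ0 : 0 < δ := by positivity
  have hδI : 4 * δ ^ 2 * I ≤ ε := by
    rw [hδ, Real.sq_sqrt (by positivity), mul_div_assoc', div_mul_eq_mul_div,
      div_le_iff₀ (by positivity)]
    nlinarith
  -- A finite δ-net of the compact set of plane waves: its points are the finitely many functionals,
  -- and δ makes the replacement error at most ε‖u‖² after integration against W.
  obtain ⟨t, ht, hcov⟩ := Metric.totallyBounded_iff.1
    (((isCompact_closedBall (0 : Space d) r).image (continuous_planeWave R)).totallyBounded) δ hδ0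
  refine ⟨ht.toFinset, 4 * I, by positivity, fun u => ?_⟩
  set B := ∑ h ∈ ht.toFinset, ‖inner ℂ h (𝓕 (u : L2 d) : L2 d)‖ ^ 2 with hB
  have hpw : ∀ x ∈ Metric.closedBall (0 : Space d) r,
      ‖inner ℂ (planeWave R x) (𝓕 (u : L2 d) : L2 d)‖ ^ 2 ≤ 2 * B + 2 * δ ^ 2 * ‖(u : L2 d)‖ ^ 2 := by
    intro x hx
    obtain ⟨h, hht, hdist⟩ := Set.mem_iUnion₂.1 (hcov (Set.mem_image_of_mem _ hx))
    have h1 : ‖inner ℂ h (𝓕 (u : L2 d) : L2 d)‖ ^ 2 ≤ B :=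
      Finset.single_le_sum (f := fun h => ‖inner ℂ h (𝓕 (u : L2 d) : L2 d)‖ ^ 2)
        (fun _ _ => by positivity) (ht.mem_toFinset.2 hht)
    have h2 : ‖inner ℂ (planeWave R x - h) (𝓕 (u : L2 d) : L2 d)‖ ≤ δ * ‖(u : L2 d)‖ := by
      refine (norm_inner_le_norm _ _).trans ?_
      rw [Lp.norm_fourier_eq]
      gcongr
      exact (mem_ball_iff_norm.1 hdist).le
    have h3 : inner ℂ (planeWave R x) (𝓕 (u : L2 d) : L2 d) =
        inner ℂ h (𝓕 (u : L2 d) : L2 d) + inner ℂ (planeWave R x - h) (𝓕 (u : L2 d) : L2 d) := by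
      rw [← inner_add_left, add_sub_cancel]
    have h4 := norm_add_le (inner ℂ h (𝓕 (u : L2 d) : L2 d))
      (inner ℂ (planeWave R x - h) (𝓕 (u : L2 d) : L2 d))
    rw [← h3] at h4
    have h5 : ‖inner ℂ (planeWave R x - h) (𝓕 (u : L2 d) : L2 d)‖ ^ 2 ≤
        (δ * ‖(u : L2 d)‖) ^ 2 := by gcongr
    have h6 : ‖inner ℂ (planeWave R x) (𝓕 (u : L2 d) : L2 d)‖ ^ 2 ≤
        (‖inner ℂ h (𝓕 (u : L2 d) : L2 d)‖ +
          ‖inner ℂ (planeWave R x - h) (𝓕 (u : L2 d) : L2 d)‖) ^ 2 := by gcongr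
    nlinarith [sq_nonneg (‖inner ℂ h (𝓕 (u : L2 d) : L2 d)‖ -
      ‖inner ℂ (planeWave R x - h) (𝓕 (u : L2 d) : L2 d)‖)]
  set T := highPart R (𝓕 (u : L2 d)) with hT
  have hpt : ∀ᵐ x, W x * ‖(u : L2 d) x‖ ^ 2 ≤
      W x * (4 * B + 4 * δ ^ 2 * ‖(u : L2 d)‖ ^ 2) + 2 * M * ‖(𝓕⁻ T : L2 d) x‖ ^ 2 := by
    filter_upwards [norm_sq_le_planeWave_add R (u : L2 d)] with x hx
    by_cases hxr : x ∈ Metric.closedBall (0 : Space d) r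
    · have h1 := hpw x hxr
      have h2 : ‖(u : L2 d) x‖ ^ 2 ≤ (4 * B + 4 * δ ^ 2 * ‖(u : L2 d)‖ ^ 2) +
          2 * ‖(𝓕⁻ T : L2 d) x‖ ^ 2 := by linarith
      refine (mul_le_mul_of_nonneg_left h2 (hW.nonneg x)).trans ?_
      rw [mul_add]
      have := mul_le_mul_of_nonneg_right (hW.le x)
        (show 0 ≤ 2 * ‖(𝓕⁻ T : L2 d) x‖ ^ 2 by positivity)
      linarith
    · rw [hW.support x hxr]
      simp only [zero_mul, zero_add]
      positivity
  have hi1 := hW.integrable.mul_const (4 * B + 4 * δ ^ 2 * ‖(u : L2 d)‖ ^ 2)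
  have hi2 := (integrable_norm_sq (𝓕⁻ T : L2 d)).const_mul (2 * M)
  have key := integral_mono_ae (hW.integrable_mul (integrable_norm_sq (u : L2 d))) (hi1.add hi2) hpt
  rw [integral_add' hi1 hi2, integral_mul_const, integral_const_mul, ← norm_sq_eq_integral,
    norm_fourierInv, ← hI] at key
  have h7 : 2 * M * ‖T‖ ^ 2 ≤ ε * gradSq u := by
    refine (mul_le_mul_of_nonneg_right hMR (sq_nonneg _)).trans ?_
    rw [mul_assoc]
    exact mul_le_mul_of_nonneg_left (norm_highPart_fourier_sq_le hR0.le u) hε.le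
  have h8 := mul_le_mul_of_nonneg_right hδI (sq_nonneg ‖(u : L2 d)‖)
  nlinarith

end IsCutoffWeight

/-! ### Hermitian forms and existence of minimizers -/

section Hermitian

variable {D : Type*} [AddCommGroup D] [Module ℂ D] {b : D →ₗ⋆[ℂ] D →ₗ[ℂ] ℂ} {F : Submodule ℂ D}

/-- Parallelogram identity with the nonnegative term for u + v dropped; it makes minimizing
sequences Cauchy. -/
theorem re_sub_le_of_nonneg_on (hpos : ∀ u ∈ F, 0 ≤ (b u u).re) {u v : D} (hu : u ∈ F)
    (hv : v ∈ F) : (b (u - v) (u - v)).re ≤ 2 * (b u u).re + 2 * (b v v).re := by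
  have h := hpos _ (F.add_mem hu hv)
  simp only [map_add, map_sub, LinearMap.add_apply, LinearMap.sub_apply, Complex.add_re,
    Complex.sub_re] at h ⊢
  linarith

/-- The Euler–Lagrange equation: a zero of a nonnegative quadratic form is a minimum, so first
variations vanish there. Testing with v and iv gives real and imaginary parts. -/
theorem eq_zero_of_re_le_zero (hherm : ∀ u v, conj (b u v) = b v u)
    (hpos : ∀ u ∈ F, 0 ≤ (b u u).re) {u : D} (hu : u ∈ F) (h0 : (b u u).re ≤ 0) {v : D}
    (hv : v ∈ F) : b v u = 0 := by
  have hre : ∀ w ∈ F, (b w u).re = 0 := by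
    intro w hw
    by_contra hne
    have hq : ∀ t : ℝ, 0 ≤ 2 * t * (b w u).re + t ^ 2 * (b w w).re := by
      intro t
      have h := hpos _ (F.add_mem hu (F.smul_mem (t : ℂ) hw))
      have h1 : (b u w).re = (b w u).re := by rw [← hherm w u, Complex.conj_re]
      simp only [map_add, LinearMap.map_smulₛₗ, LinearMap.add_apply, LinearMap.smul_apply,
        Complex.conj_ofReal, Complex.add_re, smul_eq_mul, Complex.re_ofReal_mul,
        RingHom.id_apply, h1] at h
      nlinarith
    have hB : 0 ≤ (b w w).re := hpos w hw
    -- Nearly the minimum point of the parabola; `+ 1` avoids division by zero when the form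
    -- vanishes at w.
    have h2 := hq (-(b w u).re / ((b w w).re + 1))
    have h3 : 2 * (-(b w u).re / ((b w w).re + 1)) * (b w u).re +
        (-(b w u).re / ((b w w).re + 1)) ^ 2 * (b w w).re =
        -((b w u).re ^ 2 * ((b w w).re + 2)) / ((b w w).re + 1) ^ 2 := by
      field_simp
      ring
    rw [h3] at h2
    have h4 : 0 < (b w u).re ^ 2 * ((b w w).re + 2) := by positivity
    have h5 : -((b w u).re ^ 2 * ((b w w).re + 2)) / ((b w w).re + 1) ^ 2 < 0 :=
      div_neg_of_neg_of_pos (by linarith) (by positivity)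
    linarith
  apply Complex.ext
  · simpa using hre v hv
  · have := hre _ (F.smul_mem Complex.I hv)
    simpa using this

end Hermitian

variable {W : Space d → ℝ} {M r : ℝ}

theorem schrodingerForm_add_right {V : Space d → ℝ} {v u u' : H1 d}
    (hu : Integrable (potentialIntegrand V v u)) (hu' : Integrable (potentialIntegrand V v u')) :
    schrodingerForm V v (u + u') = schrodingerForm V v u + schrodingerForm V v u' := by
  simp only [schrodingerForm, map_add, inner_add_right, Finset.sum_add_distrib]
  rw [integral_congr_ae (potentialIntegrand_add V v u u'), integral_add' hu hu']
  ring

theorem schrodingerForm_smul_right (V : Space d → ℝ) (v u : H1 d) (c : ℂ) :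
    schrodingerForm V v (c • u) = c * schrodingerForm V v u := by
  simp only [schrodingerForm, map_smul, inner_smul_right, ← Finset.mul_sum]
  rw [integral_congr_ae (potentialIntegrand_smul V v u c)]
  simp only [Pi.smul_apply, smul_eq_mul, integral_const_mul, mul_add]

/-- The sesquilinear form of `-Δ - W - m`. -/
def shiftedForm (hW : IsCutoffWeight W M r) (m : ℝ) : H1 d →ₗ⋆[ℂ] H1 d →ₗ[ℂ] ℂ :=
  LinearMap.mk₂'ₛₗ _ _
    (fun v u => schrodingerForm (-W) v u - m * inner ℂ (v : L2 d) (u : L2 d))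
    (fun v v' u => by
      rw [← schrodingerForm_conj, schrodingerForm_add_right
        (hW.integrable_potentialIntegrand _ _) (hW.integrable_potentialIntegrand _ _), map_add,
        schrodingerForm_conj, schrodingerForm_conj, Submodule.coe_add, inner_add_left]
      ring)
    (fun c v u => by
      rw [← schrodingerForm_conj, schrodingerForm_smul_right, map_mul, schrodingerForm_conj,
        Submodule.coe_smul, inner_smul_left, smul_eq_mul]
      ring)
    (fun v u u' => by
      rw [schrodingerForm_add_right (hW.integrable_potentialIntegrand _ _)
        (hW.integrable_potentialIntegrand _ _), Submodule.coe_add, inner_add_right]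
      ring)
    (fun c v u => by
      rw [schrodingerForm_smul_right, Submodule.coe_smul, inner_smul_right, RingHom.id_apply,
        smul_eq_mul]
      ring)

theorem shiftedForm_apply (hW : IsCutoffWeight W M r) (m : ℝ) (v u : H1 d) :
    shiftedForm hW m v u = schrodingerForm (-W) v u - m * inner ℂ (v : L2 d) (u : L2 d) := rfl

theorem shiftedForm_conj (hW : IsCutoffWeight W M r) (m : ℝ) (v u : H1 d) :
    conj (shiftedForm hW m v u) = shiftedForm hW m u v := by
  rw [shiftedForm_apply, map_sub, map_mul, schrodingerForm_conj, Complex.conj_ofReal,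
    inner_conj_symm, shiftedForm_apply]

theorem shiftedForm_self_re (hW : IsCutoffWeight W M r) (m : ℝ) (u : H1 d) :
    (shiftedForm hW m u u).re =
      gradSq u - (∫ x, W x * ‖(u : L2 d) x‖ ^ 2) - m * ‖(u : L2 d)‖ ^ 2 := by
  rw [shiftedForm_apply, schrodingerForm_self, inner_self_eq_norm_sq_to_K, Complex.sub_re,
    Complex.ofReal_re, Complex.re_ofReal_mul]
  simp only [Pi.neg_apply, neg_mul, integral_neg]
  norm_cast

theorem isEigen_iff_shiftedForm (hW : IsCutoffWeight W M r) (m : ℝ) (u : H1 d) :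
    IsEigen (-W) m u ↔ ∀ v, shiftedForm hW m v u = 0 := by
  simp_rw [shiftedForm_apply, sub_eq_zero]
  exact ⟨fun h v => (h v).2, fun h v => ⟨hW.integrable_potentialIntegrand v u, h v⟩⟩

/-- The `H¹` functions that are `L²`-orthogonal to a family. -/
def orthH1 {ι : Type} (φ : ι → H1 d) : Submodule ℂ (H1 d) where
  carrier := {u | ∀ i, inner ℂ (φ i : L2 d) (u : L2 d) = 0}
  add_mem' hu hv i := by rw [Submodule.coe_add, inner_add_right, hu i, hv i, add_zero]
  zero_mem' i := by simp
  smul_mem' c u hu i := by rw [Submodule.coe_smul, inner_smul_right, hu i, mul_zero]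

theorem mem_orthH1 {ι : Type} {φ : ι → H1 d} {u : H1 d} :
    u ∈ orthH1 φ ↔ ∀ i, inner ℂ (φ i : L2 d) (u : L2 d) = 0 := Iff.rfl

theorem sub_sum_mem_orthH1 {ι : Type} [Fintype ι] {φ : ι → H1 d}
    (hφ : Orthonormal ℂ fun i => (φ i : L2 d)) (u : H1 d) :
    u - ∑ i, inner ℂ (φ i : L2 d) (u : L2 d) • φ i ∈ orthH1 φ := by
  classical
  intro j
  rw [Submodule.coe_sub, inner_sub_right, sub_eq_zero, Submodule.coe_sum]
  simp_rw [Submodule.coe_smul]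
  rw [hφ.inner_right_fintype]

/-- A minimizing sequence for a negative infimum of the energy converges strongly. -/
theorem exists_minimizer {ι : Type} (hW : IsCutoffWeight W M r) (φ : ι → H1 d) {m : ℝ} (hm : m < 0)
    (hpos : ∀ u ∈ orthH1 φ, 0 ≤ (shiftedForm hW m u u).re) (u : ℕ → H1 d)
    (huF : ∀ k, u k ∈ orthH1 φ) (hu1 : ∀ k, ‖(u k : L2 d)‖ = 1)
    (hlim : Tendsto (fun k => (shiftedForm hW m (u k) (u k)).re) atTop (𝓝 0)) :
    ∃ w ∈ orthH1 φ, ‖(w : L2 d)‖ = 1 ∧ (shiftedForm hW m w w).re ≤ 0 := by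
  -- With 2ε ≤ 1 and 2ε ≤ -m the ε-term of the compactness bound is absorbed into the kinetic energy
  -- and -m‖v‖², leaving ε times the H¹ norm squared. This is where m < 0 enters.
  set ε := min 1 (-m) / 2 with hε
  have hε0 : 0 < ε := by
    have : 0 < min 1 (-m) := lt_min one_pos (by linarith)
    positivity
  have hε1 : 2 * ε ≤ 1 := by
    have := min_le_left 1 (-m); rw [hε]; linarith
  have hε2 : 2 * ε ≤ -m := by
    have := min_le_right 1 (-m); rw [hε]; linarith
  obtain ⟨s, C, hC, hcpt⟩ := hW.exists_finset_integral_le hε0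
  have hcoer : ∀ v : H1 d, ε * (gradSq v + ‖(v : L2 d)‖ ^ 2) ≤ (shiftedForm hW m v v).re +
      C * ∑ h ∈ s, ‖inner ℂ h (𝓕 (v : L2 d) : L2 d)‖ ^ 2 := by
    intro v
    have h1 := hcpt v
    rw [shiftedForm_self_re]
    nlinarith [gradSq_nonneg v, sq_nonneg ‖(v : L2 d)‖]
  let z : ℕ → (s → ℂ) := fun k h => inner ℂ (h : L2 d) (𝓕 (u k : L2 d) : L2 d)
  have hzb : ∀ k, z k ∈ Set.pi Set.univ fun h : s => Metric.closedBall (0 : ℂ) ‖(h : L2 d)‖ := by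
    intro k h _
    rw [mem_closedBall_zero_iff]
    refine (norm_inner_le_norm _ _).trans_eq ?_
    rw [Lp.norm_fourier_eq, hu1, mul_one]
  obtain ⟨z₀, -, ψ, hψ, hz⟩ :=
    (isCompact_univ_pi fun h : s => isCompact_closedBall (0 : ℂ) ‖(h : L2 d)‖).tendsto_subseq hzb
  -- Bounds the squared H¹ distance between members of the subsequence: coercivity applied to
  -- differences, the parallelogram bound for their energy, and convergence of the finitely many
  -- functionals along ψ. Convergence is thus strong, with no weak limits.
  set A : ℕ × ℕ → ℝ := fun p => (2 * (shiftedForm hW m (u (ψ p.1)) (u (ψ p.1))).re +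
    2 * (shiftedForm hW m (u (ψ p.2)) (u (ψ p.2))).re +
      C * ∑ h, ‖z (ψ p.1) h - z (ψ p.2) h‖ ^ 2) / ε with hA
  have hbound : ∀ p : ℕ × ℕ, gradSq (u (ψ p.1) - u (ψ p.2)) +
      ‖((u (ψ p.1) : L2 d) - (u (ψ p.2) : L2 d))‖ ^ 2 ≤ A p := by
    intro p
    rw [hA, le_div_iff₀' hε0]
    refine (hcoer (u (ψ p.1) - u (ψ p.2))).trans ?_
    refine add_le_add (re_sub_le_of_nonneg_on hpos (huF _) (huF _)) (le_of_eq ?_)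
    rw [← Finset.sum_coe_sort s]
    congr 1
    refine Finset.sum_congr rfl fun h _ => ?_
    rw [Submodule.coe_sub, sub_eq_add_neg, ← neg_one_smul ℂ (u (ψ p.2) : L2 d),
      FourierTransform.fourier_add, FourierTransform.fourier_smul, inner_add_right,
      inner_smul_right, neg_one_mul, ← sub_eq_add_neg]
  have hAlim : Tendsto A atTop (𝓝 0) := by
    rw [← prod_atTop_atTop_eq]
    have h1 : Tendsto (fun k => (shiftedForm hW m (u (ψ k)) (u (ψ k))).re) atTop (𝓝 0) :=
      hlim.comp hψ.tendsto_atTop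
    have h2 : ∀ h, Tendsto (fun k => z (ψ k) h) atTop (𝓝 (z₀ h)) := fun h =>
      (tendsto_pi_nhds.1 hz) h
    have h3 := (((h1.comp tendsto_fst).const_mul 2).add ((h1.comp tendsto_snd).const_mul 2)).add
      ((tendsto_finsetSum (Finset.univ : Finset s) fun h _ => ((((h2 h).comp
        (tendsto_fst (f := atTop) (g := atTop))).sub ((h2 h).comp
          (tendsto_snd (f := atTop) (g := atTop)))).norm.pow 2)).const_mul C)
    simpa using! h3.div_const ε
  have hcauchy : ∀ f : ℕ → L2 d, (∀ p : ℕ × ℕ, ‖f p.1 - f p.2‖ ^ 2 ≤ A p) → CauchySeq f := by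
    intro f hf
    rw [cauchySeq_iff_tendsto_dist_atTop_0]
    have h4 : Tendsto (fun p => Real.sqrt (A p)) atTop (𝓝 0) := by
      simpa using hAlim.sqrt
    refine squeeze_zero (fun _ => dist_nonneg) (fun p => ?_) h4
    rw [dist_eq_norm]
    exact Real.le_sqrt_of_sq_le (hf p)
  obtain ⟨f, hf⟩ := cauchySeq_tendsto_of_complete (hcauchy (fun k => (u (ψ k) : L2 d)) fun p =>
    le_trans (by have := gradSq_nonneg (u (ψ p.1) - u (ψ p.2)); linarith) (hbound p))
  have hg := fun i => cauchySeq_tendsto_of_complete (hcauchy (fun k => weakPartial i (u (ψ k)))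
    fun p => by
      refine le_trans ?_ (hbound p)
      have : ‖weakPartial i (u (ψ p.1)) - weakPartial i (u (ψ p.2))‖ ^ 2 ≤
          gradSq (u (ψ p.1) - u (ψ p.2)) := by
        rw [← map_sub]
        exact Finset.single_le_sum (f := fun i => ‖weakPartial i (u (ψ p.1) - u (ψ p.2))‖ ^ 2)
          (fun _ _ => by positivity) (Finset.mem_univ i)
      have h5 := sq_nonneg ‖((u (ψ p.1) : L2 d) - (u (ψ p.2) : L2 d))‖
      linarith)
  choose g hg using hg
  obtain ⟨w, hwf, hwg⟩ := exists_H1_of_tendsto (fun k => u (ψ k)) f g hf hg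
  have hwF : w ∈ orthH1 φ := by
    intro i
    rw [hwf]
    refine tendsto_nhds_unique (tendsto_const_nhds.inner hf) ?_
    simp_rw [(mem_orthH1.1 (huF _)) i]
    exact tendsto_const_nhds
  refine ⟨w, hwF, ?_, ?_⟩
  · rw [hwf]
    refine tendsto_nhds_unique hf.norm ?_
    simp_rw [hu1]
    exact tendsto_const_nhds
  · have h6 : Tendsto (fun k => gradSq (u (ψ k) - w) + -m * ‖(u (ψ k) : L2 d) - w‖ ^ 2) atTop
        (𝓝 0) := by
      have h7 : Tendsto (fun k => gradSq (u (ψ k) - w)) atTop (𝓝 0) := by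
        have h8 : Tendsto (fun k => ∑ i, ‖weakPartial i (u (ψ k)) - g i‖ ^ 2) atTop (𝓝 0) := by
          have := tendsto_finsetSum Finset.univ fun i (_ : i ∈ Finset.univ) =>
            (((hg i).sub_const (g i)).norm.pow 2)
          simpa using this
        refine h8.congr fun k => ?_
        simp only [gradSq, map_sub, hwg]
      have h9 := ((hf.sub_const f).norm.pow 2).const_mul (-m)
      rw [hwf]
      simpa using h7.add h9
    have h10 : Tendsto (fun k => 2 * (shiftedForm hW m (u (ψ k)) (u (ψ k))).re +
        2 * (gradSq (u (ψ k) - w) + -m * ‖(u (ψ k) : L2 d) - w‖ ^ 2)) atTop (𝓝 0) := by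
      simpa using! ((hlim.comp hψ.tendsto_atTop).const_mul 2).add (h6.const_mul 2)
    refine ge_of_tendsto' h10 fun k => ?_
    -- Applied to uₖ and uₖ - w, whose difference is w; both energies on the right have upper bounds
    -- tending to 0, so continuity of the form is not needed.
    have h11 := re_sub_le_of_nonneg_on hpos (huF (ψ k))
      ((orthH1 φ).sub_mem (huF (ψ k)) hwF)
    rw [sub_sub_cancel] at h11
    have h12 : (shiftedForm hW m (u (ψ k) - w) (u (ψ k) - w)).re ≤
        gradSq (u (ψ k) - w) + -m * ‖(u (ψ k) : L2 d) - w‖ ^ 2 := by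
      rw [shiftedForm_self_re, Submodule.coe_sub]
      have := hW.integral_mul_norm_sq_nonneg ((u (ψ k) : L2 d) - w)
      linarith
    linarith

/-! ### Producing eigenfunctions and the variational principle -/

/-- If the energy is somewhere below `-δ` on the orthogonal complement of finitely many
eigenfunctions, there is another eigenfunction with eigenvalue below `-δ`. -/
theorem exists_new_eigenfunction {ι : Type} [Fintype ι] (hW : IsCutoffWeight W M r) {φ : ι → H1 d}
    {E : ι → ℝ} (hφ : Orthonormal ℂ fun i => (φ i : L2 d)) (hφE : ∀ i, IsEigen (-W) (E i) (φ i))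
    {δ : ℝ} (hδ : 0 < δ) {u₀ : H1 d} (hu₀ : u₀ ∈ orthH1 φ)
    (hneg : (shiftedForm hW (-δ) u₀ u₀).re < 0) :
    ∃ w ∈ orthH1 φ, ‖(w : L2 d)‖ = 1 ∧ ∃ m < -δ, IsEigen (-W) m w := by
  set Q : H1 d → ℝ := fun u => (shiftedForm hW 0 u u).re with hQ
  have hQm : ∀ m u, (shiftedForm hW m u u).re = Q u - m * ‖(u : L2 d)‖ ^ 2 := fun m u => by
    rw [hQ, shiftedForm_self_re]
    simp only [shiftedForm_self_re]
    ring
  have hQs : ∀ (c : ℂ) u, Q (c • u) = ‖c‖ ^ 2 * Q u := fun c u => by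
    simp only [hQ, LinearMap.map_smulₛₗ, LinearMap.smul_apply, smul_eq_mul, RingHom.id_apply]
    rw [← mul_assoc, Complex.mul_conj', ← Complex.ofReal_pow, Complex.re_ofReal_mul]
  set S : Set ℝ := Q '' {u | u ∈ orthH1 φ ∧ ‖(u : L2 d)‖ = 1} with hS
  have hbdd : BddBelow S := by
    refine ⟨-M, ?_⟩
    rintro _ ⟨u, ⟨-, hu1⟩, rfl⟩
    have h1 := hW.integral_mul_norm_sq_le (u : L2 d)
    rw [hu1] at h1
    simp only [hQ, shiftedForm_self_re]
    linarith [gradSq_nonneg u]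
  have hnorm : ∀ u ∈ orthH1 φ, (u : L2 d) ≠ 0 → Q u / ‖(u : L2 d)‖ ^ 2 ∈ S := by
    intro u hu hu0
    have hn : ‖(u : L2 d)‖ ≠ 0 := norm_ne_zero_iff.2 hu0
    refine ⟨((‖(u : L2 d)‖⁻¹ : ℝ) : ℂ) • u, ⟨(orthH1 φ).smul_mem _ hu, ?_⟩, ?_⟩
    · rw [Submodule.coe_smul, norm_smul, Complex.norm_real, norm_inv, norm_norm,
        inv_mul_cancel₀ hn]
    · rw [hQs, Complex.norm_real, norm_inv, norm_norm, inv_pow]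
      field_simp
  have hu₀0 : (u₀ : L2 d) ≠ 0 := by
    intro h
    have : u₀ = 0 := Subtype.ext h
    rw [this] at hneg
    simp at hneg
  have hne : S.Nonempty := ⟨_, hnorm u₀ hu₀ hu₀0⟩
  set m := sInf S with hm
  have hmδ : m < -δ := by
    refine (csInf_le hbdd (hnorm u₀ hu₀ hu₀0)).trans_lt ?_
    have hn : 0 < ‖(u₀ : L2 d)‖ ^ 2 := by have := norm_pos_iff.2 hu₀0; positivity
    rw [div_lt_iff₀ hn]
    rw [hQm] at hneg
    linarith
  have hpos : ∀ u ∈ orthH1 φ, 0 ≤ (shiftedForm hW m u u).re := by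
    intro u hu
    by_cases hu0 : (u : L2 d) = 0
    · have : u = 0 := Subtype.ext hu0
      simp [this]
    · have hn : 0 < ‖(u : L2 d)‖ ^ 2 := by have := norm_pos_iff.2 hu0; positivity
      have h1 := csInf_le hbdd (hnorm u hu hu0)
      rw [le_div_iff₀ hn] at h1
      rw [hQm]
      linarith
  obtain ⟨q, -, hqlim, hqS⟩ := exists_seq_tendsto_sInf hne hbdd
  choose u hu huq using hqS
  have hlim : Tendsto (fun k => (shiftedForm hW m (u k) (u k)).re) atTop (𝓝 0) := by
    have h1 : ∀ k, (shiftedForm hW m (u k) (u k)).re = q k - m := fun k => by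
      rw [hQm, huq, (hu k).2]; ring
    simp_rw [h1]
    have := hqlim.sub_const m
    rwa [← hm, sub_self] at this
  obtain ⟨w, hwF, hw1, hw0⟩ := exists_minimizer hW φ (by linarith) hpos u (fun k => (hu k).1)
    (fun k => (hu k).2) hlim
  refine ⟨w, hwF, hw1, m, hmδ, (isEigen_iff_shiftedForm hW m w).2 fun v => ?_⟩
  -- Minimality tests only directions in the complement; the directions φᵢ are handled by their own
  -- eigenvalue equation and wᵢ-orthogonality ⟨φᵢ, w⟩ = 0.
  have hφw : ∀ i, shiftedForm hW m (φ i) w = 0 := by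
    intro i
    rw [← shiftedForm_conj, shiftedForm_apply, (hφE i w).2, ← inner_conj_symm, hwF i]
    simp
  have hv := eq_zero_of_re_le_zero (shiftedForm_conj hW m) hpos hwF hw0 (sub_sum_mem_orthH1 hφ v)
  rw [map_sub, LinearMap.sub_apply, sub_eq_zero] at hv
  rw [hv, map_sum, LinearMap.sum_apply]
  refine Finset.sum_eq_zero fun i _ => ?_
  rw [LinearMap.map_smulₛₗ, LinearMap.smul_apply, hφw, smul_zero]

theorem gradSq_sub_eq_shiftedForm_zero (hW : IsCutoffWeight W M r) (u : H1 d) :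
    gradSq u - ∫ x, W x * ‖(u : L2 d) x‖ ^ 2 = (shiftedForm hW 0 u u).re := by
  rw [shiftedForm_self_re, zero_mul, sub_zero]

/-- Below any negative threshold there are finitely many eigenfunctions, and the energy is above
the threshold on their orthogonal complement. -/
theorem exists_eigenfunctions_below (hW : IsCutoffWeight W M r)
    (hS : sumAbsNegEigenvalues (schrodingerOperator (-W)) ≠ ∞) {δ : ℝ} (hδ : 0 < δ) :
    ∃ (n : ℕ) (φ : Fin n → H1 d) (E : Fin n → ℝ), (Orthonormal ℂ fun i => (φ i : L2 d)) ∧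
      (∀ i, IsEigen (-W) (E i) (φ i)) ∧ (∀ i, E i < -δ) ∧
      ∀ u ∈ orthH1 φ, 0 ≤ (shiftedForm hW (-δ) u u).re := by
  by_contra hcon
  push Not at hcon
  -- If the extraction never stopped, n eigenvalues below -δ would contribute at least nδ for every
  -- n, contradicting finiteness of the eigenvalue sum.
  have hall : ∀ n : ℕ, ∃ (φ : Fin n → H1 d) (E : Fin n → ℝ),
      (Orthonormal ℂ fun i => (φ i : L2 d)) ∧ (∀ i, IsEigen (-W) (E i) (φ i)) ∧
        ∀ i, E i < -δ := by
    intro n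
    induction n with
    | zero => exact ⟨Fin.elim0, Fin.elim0, by simp, fun i => i.elim0, fun i => i.elim0⟩
    | succ n ih =>
      obtain ⟨φ, E, h1, h2, h3⟩ := ih
      obtain ⟨u, hu, hneg⟩ := hcon n φ E h1 h2 h3
      obtain ⟨w, hw, hw1, m, hm, hEm⟩ := exists_new_eigenfunction hW h1 h2 hδ hu hneg
      refine ⟨Fin.cons w φ, Fin.cons m E, ?_, ?_, ?_⟩
      · have : (fun i => ((Fin.cons w φ : Fin (n + 1) → H1 d) i : L2 d)) =
            Matrix.vecCons (w : L2 d) fun i => (φ i : L2 d) := by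
          funext i
          refine Fin.cases ?_ (fun j => ?_) i <;> simp
        rw [this, orthonormal_vecCons_iff]
        exact ⟨hw1, fun i => by rw [← inner_conj_symm, hw i, map_zero], h1⟩
      · exact fun i => Fin.cases (by simpa using hEm) (fun j => by simpa using h2 j) i
      · exact fun i => Fin.cases (by simpa using hm) (fun j => by simpa using h3 j) i
  obtain ⟨n, hn⟩ := exists_nat_gt
    ((sumAbsNegEigenvalues (schrodingerOperator (-W))).toReal / δ)
  obtain ⟨φ, E, h1, h2, h3⟩ := hall n
  have h4 := sum_le_sumAbsNegEigenvalues h1 h2 fun i => (h3 i).trans (by linarith)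
  rw [← ENNReal.ofReal_sum_of_nonneg fun _ _ => abs_nonneg _,
    ENNReal.ofReal_le_iff_le_toReal hS] at h4
  have h5 : (n : ℝ) * δ ≤ ∑ i, |E i| := by
    calc (n : ℝ) * δ = ∑ _i : Fin n, δ := by simp
      _ ≤ _ := Finset.sum_le_sum fun i _ => by
        rw [abs_of_neg ((h3 i).trans (by linarith))]; linarith [h3 i]
  rw [div_lt_iff₀ hδ] at hn
  linarith

/-- Split u into its projection p on the span of the φᵢ and a remainder of energy at least -δ times
its squared norm. All pairings of p with u reduce to that of p with itself by the eigenvalue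
equation, so the form splits without cross terms. -/
theorem le_shiftedForm_zero {n : ℕ} (hW : IsCutoffWeight W M r) {φ : Fin n → H1 d} {E : Fin n → ℝ}
    (hφ : Orthonormal ℂ fun i => (φ i : L2 d)) (hφE : ∀ i, IsEigen (-W) (E i) (φ i)) {δ : ℝ}
    (hδ : 0 < δ) (hpos : ∀ u ∈ orthH1 φ, 0 ≤ (shiftedForm hW (-δ) u u).re) (u : H1 d) :
    ∑ i, E i * ‖inner ℂ (φ i : L2 d) (u : L2 d)‖ ^ 2 - δ * ‖(u : L2 d)‖ ^ 2 ≤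
      (shiftedForm hW 0 u u).re := by
  set c : Fin n → ℂ := fun i => inner ℂ (φ i : L2 d) (u : L2 d) with hc
  set p : H1 d := ∑ i, c i • φ i with hp
  have hF := sub_sum_mem_orthH1 hφ u
  have h1 := hpos _ hF
  have hform : ∀ (m : ℝ) (v : H1 d), shiftedForm hW m v p =
      ∑ i, c i * ((E i - m : ℝ) * inner ℂ (v : L2 d) (φ i : L2 d)) := fun m v => by
    rw [hp, map_sum]
    refine Finset.sum_congr rfl fun i _ => ?_
    rw [map_smul, smul_eq_mul, shiftedForm_apply, (hφE i v).2]
    push_cast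
    ring
  have hup : shiftedForm hW (-δ) u p = ((∑ i, (E i + δ) * ‖c i‖ ^ 2 : ℝ) : ℂ) := by
    rw [hform]
    push_cast
    refine Finset.sum_congr rfl fun i _ => ?_
    rw [← inner_conj_symm, ← Complex.mul_conj' (c i)]
    ring
  have hpp : shiftedForm hW (-δ) p p = ((∑ i, (E i + δ) * ‖c i‖ ^ 2 : ℝ) : ℂ) := by
    rw [hform]
    push_cast
    refine Finset.sum_congr rfl fun i _ => ?_
    have : inner ℂ (φ i : L2 d) (p : L2 d) = c i := by
      rw [hp, Submodule.coe_sum]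
      simp_rw [Submodule.coe_smul]
      exact hφ.inner_right_fintype _ _
    rw [← inner_conj_symm, this, ← Complex.mul_conj' (c i)]
    ring
  have hpu : shiftedForm hW (-δ) p u = ((∑ i, (E i + δ) * ‖c i‖ ^ 2 : ℝ) : ℂ) := by
    rw [← shiftedForm_conj, hup, Complex.conj_ofReal]
  simp only [map_sub, LinearMap.sub_apply] at h1
  rw [hpp, hpu, hup, sub_self, sub_zero, Complex.sub_re, Complex.ofReal_re] at h1
  have h2 : (shiftedForm hW (-δ) u u).re =
      (shiftedForm hW 0 u u).re + δ * ‖(u : L2 d)‖ ^ 2 := by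
    rw [shiftedForm_self_re, shiftedForm_self_re]; ring
  have h3 : ∑ i, E i * ‖c i‖ ^ 2 ≤ ∑ i, (E i + δ) * ‖c i‖ ^ 2 :=
    Finset.sum_le_sum fun i _ => by
      have := sq_nonneg ‖c i‖
      nlinarith
  linarith

/-- The variational principle for the sum of the negative eigenvalues. -/
theorem variational_principle (hW : IsCutoffWeight W M r)
    (hS : sumAbsNegEigenvalues (schrodingerOperator (-W)) ≠ ∞) {N : ℕ} (u : Fin N → H1 d)
    (hu : Orthonormal ℂ fun n => (u n : L2 d)) :
    ∫ x, W x * density (fun n => (u n : L2 d)) x ≤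
      ∑ n, gradSq (u n) + (sumAbsNegEigenvalues (schrodingerOperator (-W))).toReal := by
  have hsum : ∫ x, W x * density (fun n => (u n : L2 d)) x =
      ∑ n, ∫ x, W x * ‖(u n : L2 d) x‖ ^ 2 := by
    simp only [density, Finset.mul_sum]
    exact integral_finsetSum _ fun n _ => hW.integrable_mul (integrable_norm_sq _)
  have hδ : ∀ δ > 0, -(sumAbsNegEigenvalues (schrodingerOperator (-W))).toReal - δ * N ≤
      ∑ n, (shiftedForm hW 0 (u n) (u n)).re := by
    intro δ hδ
    obtain ⟨k, φ, E, h1, h2, h3, h4⟩ := exists_eigenfunctions_below hW hS hδ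
    have h0 : ∀ i, E i < 0 := fun i => (h3 i).trans (by linarith)
    have h5 := sum_le_sumAbsNegEigenvalues h1 h2 h0
    rw [← ENNReal.ofReal_sum_of_nonneg fun _ _ => abs_nonneg _,
      ENNReal.ofReal_le_iff_le_toReal hS] at h5
    have h6 := Finset.sum_le_sum fun n (_ : n ∈ Finset.univ) =>
      le_shiftedForm_zero hW h1 h2 hδ h4 (u n)
    rw [Finset.sum_sub_distrib, Finset.sum_comm] at h6
    have h7 : ∑ n, δ * ‖(u n : L2 d)‖ ^ 2 = δ * N := by
      simp [hu.1, mul_comm]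
    have h8 : -∑ i, |E i| ≤ ∑ i, ∑ n, E i * ‖inner ℂ (φ i : L2 d) (u n : L2 d)‖ ^ 2 := by
      rw [← Finset.sum_neg_distrib]
      refine Finset.sum_le_sum fun i _ => ?_
      rw [abs_of_neg (h0 i), neg_neg, ← Finset.mul_sum]
      -- Bessel for the family u: each eigenvalue is counted with total weight at most 1.
      have h9 := hu.sum_inner_products_le (φ i : L2 d) (s := Finset.univ)
      simp_rw [norm_inner_symm _ (φ i : L2 d), h1.1 i] at h9
      nlinarith [h0 i]
    linarith
  have hlim : Tendsto (fun δ : ℝ => -(sumAbsNegEigenvalues (schrodingerOperator (-W))).toReal -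
      δ * N) (𝓝[>] 0) (𝓝 (-(sumAbsNegEigenvalues (schrodingerOperator (-W))).toReal - 0 * N)) :=
    ((Continuous.tendsto (by fun_prop) 0).mono_left nhdsWithin_le_nhds)
  have h10 := le_of_tendsto hlim (Filter.eventually_of_mem self_mem_nhdsWithin hδ)
  simp_rw [← gradSq_sub_eq_shiftedForm_zero] at h10
  rw [Finset.sum_sub_distrib, ← hsum] at h10
  linarith

/-! ### Duality: from Schrödinger operators to orthonormal functions -/

/-- The truncated power of the density used as test potential. -/
def testWeight {N : ℕ} (u : Fin N → L2 d) (c : ℝ) (k : ℕ) : Space d → ℝ :=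
  (Metric.closedBall (0 : Space d) k).indicator fun x => c * min (density u x ^ (2 / d : ℝ)) k

theorem isCutoffWeight_testWeight {N : ℕ} (u : Fin N → L2 d) {c : ℝ} (hc : 0 ≤ c) (k : ℕ) :
    IsCutoffWeight (testWeight u c k) (c * k) k where
  measurable := Measurable.indicator
    ((((measurable_density u).pow_const _).min measurable_const).const_mul c)
    measurableSet_closedBall
  nonneg x := Set.indicator_nonneg (fun x _ => mul_nonneg hc
    (le_min (Real.rpow_nonneg (density_nonneg u x) _) k.cast_nonneg)) x
  le x := by
    by_cases h : x ∈ Metric.closedBall (0 : Space d) k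
    · rw [testWeight, Set.indicator_of_mem h]
      exact mul_le_mul_of_nonneg_left (min_le_right _ _) hc
    · rw [testWeight, Set.indicator_of_notMem h]
      positivity
  support x hx := Set.indicator_of_notMem hx _

theorem testWeight_le {N : ℕ} (u : Fin N → L2 d) {c : ℝ} (hc : 0 ≤ c) (k : ℕ) (x : Space d) :
    testWeight u c k x ≤ c * density u x ^ (2 / d : ℝ) := by
  by_cases h : x ∈ Metric.closedBall (0 : Space d) k
  · rw [testWeight, Set.indicator_of_mem h]
    exact mul_le_mul_of_nonneg_left (min_le_left _ _) hc
  · rw [testWeight, Set.indicator_of_notMem h]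
    exact mul_nonneg hc (Real.rpow_nonneg (density_nonneg u x) _)

/-- Write Wᵖ = W·W^(d/2) and use W ≤ cρ^(2/d) in the second factor only, so that the right side is
again the truncated quantity Wρ. -/
theorem testWeight_rpow_le (hd : 1 ≤ d) {N : ℕ} (u : Fin N → L2 d) {c : ℝ} (hc : 0 ≤ c) (k : ℕ)
    (x : Space d) : testWeight u c k x ^ (1 + d / 2 : ℝ) ≤
      c ^ (d / 2 : ℝ) * (testWeight u c k x * density u x) := by
  have hd0 : (0 : ℝ) < d := by exact_mod_cast hd
  have h0 := (isCutoffWeight_testWeight u hc k).nonneg x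
  have hρ := density_nonneg u x
  rw [Real.rpow_one_add' h0 (by positivity), mul_left_comm]
  refine mul_le_mul_of_nonneg_left ?_ h0
  refine (Real.rpow_le_rpow h0 (testWeight_le u hc k x) (by positivity)).trans_eq ?_
  rw [Real.mul_rpow hc (by positivity), ← Real.rpow_mul hρ]
  have : (2 / d * (d / 2) : ℝ) = 1 := by field_simp
  rw [this, Real.rpow_one]

theorem monotone_testWeight {N : ℕ} (u : Fin N → L2 d) {c : ℝ} (hc : 0 ≤ c) (x : Space d) :
    Monotone fun k => testWeight u c k x := by
  intro k l hkl
  have hkl' : (k : ℝ) ≤ l := by exact_mod_cast hkl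
  have h1 : (Metric.closedBall (0 : Space d) k) ⊆ Metric.closedBall 0 l :=
    Metric.closedBall_subset_closedBall hkl'
  have h2 : 0 ≤ density u x ^ (2 / d : ℝ) := Real.rpow_nonneg (density_nonneg u x) _
  classical
  simp only [testWeight, Set.indicator_apply]
  split_ifs with h3 h4 h4
  · gcongr
  · exact absurd (h1 h3) h4
  · exact mul_nonneg hc (le_min h2 l.cast_nonneg)
  · exact le_rfl

theorem tendsto_testWeight {N : ℕ} (u : Fin N → L2 d) (c : ℝ) (x : Space d) :
    Tendsto (fun k => testWeight u c k x) atTop (𝓝 (c * density u x ^ (2 / d : ℝ))) := by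
  refine tendsto_const_nhds.congr' ?_
  filter_upwards [eventually_ge_atTop ⌈‖x‖⌉₊, eventually_ge_atTop ⌈density u x ^ (2 / d : ℝ)⌉₊]
    with k h1 h2
  rw [testWeight, Set.indicator_of_mem (by simpa using Nat.ceil_le.1 h1),
    min_eq_left (Nat.ceil_le.1 h2)]

theorem DualConstants.pos {L K : ℝ≥0} (h : DualConstants d L K) (hd : 1 ≤ d) :
    0 < L ∧ 0 < K := by
  have hd0 : (0 : ℝ) < d := by exact_mod_cast hd
  constructor <;> rw [pos_iff_ne_zero] <;> rintro rfl <;> rw [DualConstants] at h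
  · simp at h
  · rw [NNReal.coe_zero, mul_zero, Real.zero_rpow (by positivity), mul_zero] at h
    exact zero_ne_one h

/-- Duality: the inequality for Schrödinger operators implies the one for orthonormal functions. -/
theorem OrthonormalLT.of_schrodingerLT (hd : 1 ≤ d) {L K : ℝ≥0} (hLK : DualConstants d L K)
    (h : SchrodingerLT d L) : OrthonormalLT d K := by
  have hd0 : (0 : ℝ) < d := by exact_mod_cast hd
  obtain ⟨hL, hK⟩ := hLK.pos hd
  intro N u hu
  simp_rw [lintegral_weakPartial_sq]
  rw [← ENNReal.ofReal_sum_of_nonneg fun _ _ => gradSq_nonneg _]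
  set G := ∑ n, gradSq (u n) with hG
  set ρ := density fun n => (u n : L2 d) with hρ
  have hρ0 : ∀ x, 0 ≤ ρ x := density_nonneg _
  -- qKρ^(2/d) is the derivative of Kρ^q, the equality case of Young's inequality, so duality loses
  -- no constant.
  set c : ℝ := (1 + 2 / d : ℝ) * K with hc
  have hK' : (0 : ℝ) < K := hK
  have hc0 : 0 < c := by positivity
  set W := testWeight (fun n => (u n : L2 d)) c with hWdef
  have hW : ∀ k, IsCutoffWeight (W k) (c * k) k := isCutoffWeight_testWeight _ hc0.le
  have hWρ : ∀ k, Integrable fun x => W k x * ρ x := fun k =>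
    (hW k).integrable_mul (integrable_finsetSum _ fun n _ => integrable_norm_sq _)
  have hbound : ∀ k, ∫ x, W k x * ρ x ≤ (1 + 2 / d : ℝ) * G := by
    intro k
    set J := ∫ x, W k x * ρ x with hJ
    have hJ0 : 0 ≤ J := integral_nonneg fun x => mul_nonneg ((hW k).nonneg x) (hρ0 x)
    have h1 := h (-W k) ((hW k).memLp _).neg
    have h2 : ∫⁻ x, ENNReal.ofReal (max (-(-W k) x) 0 ^ (1 + d / 2 : ℝ)) ≤
        ENNReal.ofReal (c ^ (d / 2 : ℝ) * J) := by
      rw [hJ, ← integral_const_mul, ofReal_integral_eq_lintegral_ofReal ((hWρ k).const_mul _)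
        (ae_of_all _ fun x => mul_nonneg (by positivity)
          (mul_nonneg ((hW k).nonneg x) (hρ0 x)))]
      refine lintegral_mono fun x => ENNReal.ofReal_le_ofReal ?_
      rw [Pi.neg_apply, neg_neg, max_eq_left ((hW k).nonneg x)]
      exact testWeight_rpow_le hd _ hc0.le k x
    have h3 : sumAbsNegEigenvalues (schrodingerOperator (-W k)) ≤
        ENNReal.ofReal (L * (c ^ (d / 2 : ℝ) * J)) := by
      refine h1.trans ?_
      rw [ENNReal.ofReal_mul L.coe_nonneg, ENNReal.ofReal_coe_nnreal]
      gcongr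
    have h4 := ne_top_of_le_ne_top ENNReal.ofReal_ne_top h3
    have h5 := variational_principle (hW k) h4 u hu
    have h6 := ENNReal.toReal_le_of_le_ofReal (by positivity) h3
    have h7 : L * (c ^ (d / 2 : ℝ) * J) = J / (1 + d / 2 : ℝ) := by
      have h8 : (1 + d / 2 : ℝ) * L * c ^ (d / 2 : ℝ) = 1 := hLK
      rw [eq_div_iff (by positivity)]
      linear_combination J * h8
    rw [h7] at h6
    -- J is finite because W is truncated, so J/p may be subtracted; 1 - 1/p = 1/q. The truncation
    -- is then removed by monotone convergence.
    have h9 : J ≤ G + J / (1 + d / 2 : ℝ) := by linarith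
    have h10 : J - J / (1 + d / 2 : ℝ) = J / (1 + 2 / d : ℝ) := by
      field_simp
      ring
    have h11 : J / (1 + 2 / d : ℝ) ≤ G := by linarith
    rwa [div_le_iff₀' (by positivity)] at h11
  have hmain : ∫⁻ x, ENNReal.ofReal (c * ρ x ^ (2 / d : ℝ) * ρ x) ≤
      ENNReal.ofReal ((1 + 2 / d : ℝ) * G) := by
    have hlim := lintegral_tendsto_of_tendsto_of_monotone (μ := volume)
      (f := fun k x => ENNReal.ofReal (W k x * ρ x))
      (F := fun x => ENNReal.ofReal (c * ρ x ^ (2 / d : ℝ) * ρ x))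
      (fun k => (hWρ k).aestronglyMeasurable.aemeasurable.ennreal_ofReal)
      (ae_of_all _ fun x k l hkl => ENNReal.ofReal_le_ofReal
        (mul_le_mul_of_nonneg_right (monotone_testWeight _ hc0.le x hkl) (hρ0 x)))
      (ae_of_all _ fun x => ENNReal.tendsto_ofReal ((tendsto_testWeight _ c x).mul_const _))
    refine le_of_tendsto' hlim fun k => ?_
    rw [← ofReal_integral_eq_lintegral_ofReal (hWρ k)
      (ae_of_all _ fun x => mul_nonneg ((hW k).nonneg x) (hρ0 x))]
    exact ENNReal.ofReal_le_ofReal (hbound k)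
  have hq : (0 : ℝ) < 1 + 2 / d := by positivity
  have heq : ∫⁻ x, ENNReal.ofReal (c * ρ x ^ (2 / d : ℝ) * ρ x) =
      ENNReal.ofReal (1 + 2 / d : ℝ) * (K * ∫⁻ x, ENNReal.ofReal (ρ x ^ (1 + 2 / d : ℝ))) := by
    rw [← lintegral_const_mul' _ _ ENNReal.coe_ne_top,
      ← lintegral_const_mul' _ _ ENNReal.ofReal_ne_top]
    refine lintegral_congr fun x => ?_
    rw [← ENNReal.ofReal_coe_nnreal, ← ENNReal.ofReal_mul K.coe_nonneg,
      ← ENNReal.ofReal_mul hq.le, Real.rpow_one_add' (hρ0 x) hq.ne', hc]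
    congr 1
    ring
  rw [heq, ENNReal.ofReal_mul hq.le] at hmain
  exact (ENNReal.mul_le_mul_iff_right (ENNReal.ofReal_pos.2 hq).ne' ENNReal.ofReal_ne_top).1 hmain

/-! ### Optimal constants -/

/-- Admissible constants for orthonormal functions are bounded. -/
theorem bddAbove_orthonormalLT (hd : 1 ≤ d) : BddAbove {K : ℝ≥0 | OrthonormalLT d K} := by
  have hd0 : (0 : ℝ) < d := by exact_mod_cast hd
  have : Nonempty (Fin d) := ⟨⟨0, hd⟩⟩
  have hex : ∃ f : L2 d, f ≠ 0 := by
    refine ⟨planeWave 1 0, fun h => ?_⟩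
    have h1 := norm_planeWave_sq (d := d) 1 0
    rw [h, norm_zero] at h1
    have := volume_real_ball_one_pos (d := d)
    norm_num at h1
    linarith
  obtain ⟨f, hf⟩ := hex
  -- One normalized H¹ function, as a family with N = 1, bounds every admissible K by a finite
  -- quotient.
  obtain ⟨v, hvne, hvmem⟩ := (dense_H1 d).inter_open_nonempty {0}ᶜ isOpen_compl_singleton ⟨f, hf⟩
  have hv0 : ‖v‖ ≠ 0 := norm_ne_zero_iff.2 hvne
  set u : H1 d := ((‖v‖⁻¹ : ℝ) : ℂ) • ⟨v, hvmem⟩ with hu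
  have hu1 : ‖(u : L2 d)‖ = 1 := by
    rw [hu, Submodule.coe_smul, norm_smul, Complex.norm_real, norm_inv, norm_norm,
      inv_mul_cancel₀ hv0]
  set I := ∫⁻ x, ENNReal.ofReal ((‖(u : L2 d) x‖ ^ 2) ^ (1 + 2 / d : ℝ)) with hI
  have hq : (1 + 2 / d : ℝ) ≠ 0 := by positivity
  have hI0 : I ≠ 0 := by
    intro h0
    rw [hI, lintegral_eq_zero_iff' (((Lp.stronglyMeasurable (u : L2 d)).measurable.norm.pow_const
      2).pow_const _).ennreal_ofReal.aemeasurable] at h0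
    have hz : (u : L2 d) = 0 := by
      rw [Lp.eq_zero_iff_ae_eq_zero]
      filter_upwards [h0] with x hx
      have h1 := ENNReal.ofReal_eq_zero.1 hx
      have h2 := (Real.rpow_eq_zero (sq_nonneg _) hq).1
        (le_antisymm h1 (Real.rpow_nonneg (sq_nonneg ‖(u : L2 d) x‖) _))
      simpa using h2
    rw [hz, norm_zero] at hu1
    exact zero_ne_one hu1
  have hfin : ENNReal.ofReal (gradSq u) / I ≠ ∞ := ENNReal.div_ne_top ENNReal.ofReal_ne_top hI0
  refine ⟨(ENNReal.ofReal (gradSq u) / I).toNNReal, fun K hK => ?_⟩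
  have horth : Orthonormal ℂ fun _ : Unit => (u : L2 d) :=
    ⟨fun _ => hu1, fun i j hij => absurd (Subsingleton.elim i j) hij⟩
  have h1 := OrthonormalLT.fintype hK (fun _ : Unit => u) horth
  simp only [Finset.univ_unique, Finset.sum_const, Finset.card_singleton, one_smul] at h1
  rw [← ENNReal.coe_le_coe, ENNReal.coe_toNNReal hfin]
  rw [ENNReal.le_div_iff_mul_le (Or.inl hI0) (Or.inr ENNReal.ofReal_ne_top)]
  exact h1

theorem DualConstants.rpow_mul_rpow_eq_one (hd : 1 ≤ d) {L K : ℝ≥0} (h : DualConstants d L K) :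
    ((1 + d / 2 : ℝ) * L) ^ (1 + 2 / d : ℝ) * ((1 + 2 / d : ℝ) * K) ^ (1 + d / 2 : ℝ) = 1 := by
  have hd0 : (0 : ℝ) < d := by exact_mod_cast hd
  have h1 : ((1 + d / 2 : ℝ) * L * ((1 + 2 / d : ℝ) * K) ^ (d / 2 : ℝ)) ^ (1 + 2 / d : ℝ) =
      ((1 + d / 2 : ℝ) * L) ^ (1 + 2 / d : ℝ) * ((1 + 2 / d : ℝ) * K) ^ (1 + d / 2 : ℝ) := by
    rw [Real.mul_rpow (by positivity) (by positivity), ← Real.rpow_mul (by positivity)]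
    congr 2
    field_simp
    ring
  rw [DualConstants] at h
  rw [← h1, h, Real.one_rpow]

theorem exists_dualConstants_left (hd : 1 ≤ d) {K : ℝ≥0} (hK : 0 < K) :
    ∃ L, DualConstants d L K := by
  have hd0 : (0 : ℝ) < d := by exact_mod_cast hd
  have hK' : (0 : ℝ) < K := hK
  refine ⟨((1 + d / 2 : ℝ)⁻¹ * (((1 + 2 / d : ℝ) * K) ^ (d / 2 : ℝ))⁻¹).toNNReal, ?_⟩
  rw [DualConstants, Real.coe_toNNReal _ (by positivity)]
  field_simp

theorem exists_dualConstants_right (hd : 1 ≤ d) {L : ℝ≥0} (hL : 0 < L) :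
    ∃ K, DualConstants d L K := by
  have hd0 : (0 : ℝ) < d := by exact_mod_cast hd
  have hL' : (0 : ℝ) < L := hL
  refine ⟨((1 + 2 / d : ℝ)⁻¹ * ((1 + d / 2 : ℝ) * L) ^ (-(2 / d) : ℝ)).toNNReal, ?_⟩
  rw [DualConstants, Real.coe_toNNReal _ (by positivity), mul_inv_cancel_left₀ (by positivity),
    ← Real.rpow_mul (by positivity)]
  have : (-(2 / d) * (d / 2) : ℝ) = -1 := by field_simp
  rw [this, Real.rpow_neg_one]
  exact mul_inv_cancel₀ (by positivity)

theorem DualConstants.le_of_le (hd : 1 ≤ d) {L K L' K' : ℝ≥0} (h : DualConstants d L K)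
    (h' : DualConstants d L' K') (hL : L ≤ L') : K' ≤ K := by
  have hd0 : (0 : ℝ) < d := by exact_mod_cast hd
  by_contra! hK
  have hL0 : (0 : ℝ) < L := (h.pos hd).1
  have hL' : (L : ℝ) ≤ L' := by exact_mod_cast hL
  have hK' : (K : ℝ) < K' := by exact_mod_cast hK
  rw [DualConstants] at h h'
  have h1 : ((1 + 2 / d : ℝ) * K) ^ (d / 2 : ℝ) < ((1 + 2 / d : ℝ) * K') ^ (d / 2 : ℝ) :=
    Real.rpow_lt_rpow (by positivity) (by gcongr) (by positivity)
  have h2 : (1 + d / 2 : ℝ) * L * ((1 + 2 / d : ℝ) * K) ^ (d / 2 : ℝ) <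
      (1 + d / 2 : ℝ) * L' * ((1 + 2 / d : ℝ) * K') ^ (d / 2 : ℝ) := by
    calc _ < (1 + d / 2 : ℝ) * L * ((1 + 2 / d : ℝ) * K') ^ (d / 2 : ℝ) := by gcongr
      _ ≤ _ := by gcongr
  rw [h, h'] at h2
  exact lt_irrefl _ h2

/-- Finiteness is needed to pass to the limit in the constant when the infimum of admissible L is
attained: in `ℝ≥0∞` multiplication by `∞` is not continuous at 0. -/
theorem lintegral_negPart_rpow_ne_top {V : Space d → ℝ}
    (hV : MemLp V (ENNReal.ofReal (1 + d / 2)) volume) :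
    ∫⁻ x, ENNReal.ofReal (max (-V x) 0 ^ (1 + d / 2 : ℝ)) ≠ ∞ := by
  have hp : (0 : ℝ) < 1 + d / 2 := by positivity
  have h := lintegral_rpow_enorm_lt_top_of_eLpNorm_lt_top (ENNReal.ofReal_pos.2 hp).ne'
    ENNReal.ofReal_ne_top hV.2
  rw [ENNReal.toReal_ofReal hp.le] at h
  refine ne_top_of_le_ne_top h.ne (lintegral_mono fun x => ?_)
  rw [← ofReal_norm, ENNReal.ofReal_rpow_of_nonneg (norm_nonneg _) hp.le]
  refine ENNReal.ofReal_le_ofReal (Real.rpow_le_rpow (le_max_right _ _) ?_ hp.le)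
  exact max_le (neg_le_abs _) (norm_nonneg _)

/-- The set of admissible constants for Schrödinger operators has a least element. -/
theorem exists_isLeast_schrodingerLT (hne : ∃ L, SchrodingerLT d L) :
    ∃ L, IsLeast {L : ℝ≥0 | SchrodingerLT d L} L := by
  refine ⟨sInf {L : ℝ≥0 | SchrodingerLT d L}, fun V hV => ?_, fun L hL => csInf_le' hL⟩
  obtain ⟨L, -, hlim, hL⟩ := exists_seq_tendsto_sInf (S := {L : ℝ≥0 | SchrodingerLT d L}) hne
    (OrderBot.bddBelow _)
  refine ge_of_tendsto' (ENNReal.Tendsto.mul_const (ENNReal.tendsto_coe.2 hlim)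
    (Or.inr (lintegral_negPart_rpow_ne_top hV))) fun k => hL k V hV

end LiebThirring

end

theorem mainTheorem3 (d : ℕ) (hd : 1 ≤ d) :
    (∃ L : ℝ≥0, LiebThirring.SchrodingerLT d L) ∧
      ∃ L K : ℝ≥0,
        IsLeast {L' : ℝ≥0 | LiebThirring.SchrodingerLT d L'} L ∧
        IsGreatest {K' : ℝ≥0 | LiebThirring.OrthonormalLT d K'} K ∧
        ((1 + d / 2 : ℝ) * L) ^ (1 + 2 / d : ℝ) * ((1 + 2 / d : ℝ) * K) ^ (1 + d / 2 : ℝ) = 1 := by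
  have hex : ∃ L : ℝ≥0, LiebThirring.SchrodingerLT d L := by
    obtain ⟨K, hK, hKLT⟩ := LiebThirring.exists_orthonormalLT hd
    obtain ⟨L, hLK⟩ := LiebThirring.exists_dualConstants_left hd hK
    exact ⟨L, .of_orthonormalLT hd hK hLK hKLT⟩
  obtain ⟨L, hL⟩ := LiebThirring.exists_isLeast_schrodingerLT hex
  have hL0 : 0 < L := by
    rw [pos_iff_ne_zero]
    -- If L = 0 were admissible, every L' would be, in particular the dual of `B + 1`; then `B + 1`
    -- would be admissible for orthonormal functions, beyond the bound B.
    rintro rfl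
    obtain ⟨B, hB⟩ := LiebThirring.bddAbove_orthonormalLT hd
    have hB1 : 0 < B + 1 := by positivity
    obtain ⟨L', h'⟩ := LiebThirring.exists_dualConstants_left hd hB1
    have hL' : LiebThirring.SchrodingerLT d L' := fun V hV =>
      (hL.1 V hV).trans (by gcongr; exact zero_le)
    exact absurd (hB (LiebThirring.OrthonormalLT.of_schrodingerLT hd h' hL'))
      (not_le.2 (lt_add_of_pos_right B one_pos))
  obtain ⟨K, hLK⟩ := LiebThirring.exists_dualConstants_right hd hL0
  refine ⟨hex, L, K, hL, ⟨.of_schrodingerLT hd hLK hL.1, fun K' hK' => ?_⟩,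
    hLK.rpow_mul_rpow_eq_one hd⟩
  rcases eq_or_lt_of_le (zero_le (a := K')) with h0 | h0
  · exact h0 ▸ zero_le
  · obtain ⟨L', h'⟩ := LiebThirring.exists_dualConstants_left hd h0
    exact hLK.le_of_le hd h' (hL.2 (.of_orthonormalLT hd h0 h' hK'))
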